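/- Setting. Let $E\subset\mathbb R^g$, $F\subset\mathbb R^k$, $L\subset\mathbb R^d$ be Borel sets, $p$ a probability kernel from $F$ to $E$, $f:F\times E\times L\to F$ measurable, and $X=(X_t)_{t\in\mathbb Z}$ a stationary and ergodic $L$-valued process on a probability space $(\Omega,\mathcal A,\mathbb P)$. For $x\in L$ let $P_x$ be the Markov kernel on $F$ with $P_xh(s)=\int h(f(s,y,x))\,p(dy\mid s)$. Assume: (A1) there are a norm $|\cdot|$ (on $\mathbb R^k$, restricted to $F$) and a measurable $\kappa:L\to\mathbb R_+$ with $\mathbb E\log^+\kappa(X_0)<\infty$, $\mathbb E\log\kappa(X_0)<0$ (the value $-\infty$ being allowed) and $|f(s,y,x)-f(s',y,x)|\le\kappa(x)|s-s'|$ for all $s,s'\in F$, $y\in E$, $x\in L$; (A2) there are measurable $\gamma,\delta:L\to\mathbb R_+$, $V:F\to\mathbb R_+$ and $\alpha\in(0,1]$ with $\mathbb E\log^+\delta(X_0)<\infty$, $\mathbb E\log^+\gamma(X_0)<\infty$, $\mathbb E\log\gamma(X_0)<0$ (again possibly $-\infty$), $V(s)\ge|s|^\alpha$ and $P_xV(s)\le\gamma(x)V(s)+\delta(x)$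 for all $s\in F$, $x\in L$; (A3) there is a nonzero polynomial $\phi$ with nonnegative coefficients and $\phi(0)=0$ such that $d_{TV}(p(\cdot\mid s),p(\cdot\mid s'))\le 1-\exp(-\phi(|s-s'|))$ for all $s,s'\in F$, where $d_{TV}(\mu,\nu)=\sup_A|\mu(A)-\nu(A)|$. Write $\kappa_t=\kappa(X_t)$, $\gamma_t=\gamma(X_t)$, $\delta_t=\delta(X_t)$. For an integer $h\ge1$ and a real $C>1$, call $t\in\mathbb Z$ a good time of $\omega$ if, at $\omega$, $$\delta_{t-1}+\sum_{i\ge1}\gamma_{t-1}\cdots\gamma_{t-i}\,\delta_{t-i-1}\le C,\quad \sup_{j\ge h}\gamma_{t-1}\cdots\gamma_{t-j}\le1-\tfrac1C,\quad \sup_{j\ge h}\kappa_{t-1}\cdots\kappa_{t-j}\le1-\tfrac1C,\quad \sum_{s\ge0}\phi(\kappa_{t+s}\cdots\kappa_t)\le C.$$ Let $\tau_0(\omega)=0$, let $\tau_{i+1}(\omega)$ be the first good time $t$ of $\omega$ with $t>\tau_i(\omega)+h$ ($\infty$ if there is none), and $M_n(\omega)=\sup\{i\ge0:\tau_i(\omega)\le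 n\}$. Let $\mathcal W_1(\mu,\nu)=\inf_\pi\int\min(|s-s'|,1)\,\pi(ds,ds')$, the infimum being over all couplings $\pi$ of the probability measures $\mu,\nu$ on $F$. Proposition. For every $C>1$, $\alpha\in(0,1]$ and $\phi$ as above there exist $\overline C>0$ and $\overline\rho\in(0,1)$, depending only on $C$, $\alpha$ and $\phi$, such that in every setting satisfying (A1)-(A3) with this $\alpha$ and $\phi$, and for every integer $h\ge1$, for $\mathbb P$-almost every $\omega$, for all $n\ge0$ and all $s,s'\in F$, $$\mathcal W_1\left(\delta_sP_{X_0(\omega)}\cdots P_{X_{n-1}(\omega)},\ \delta_{s'}P_{X_0(\omega)}\cdots P_{X_{n-1}(\omega)}\right)\le\overline C\,\bigl(1+V(s)+V(s')\bigr)\,\overline\rho^{\sqrt{M_n(\omega)}}.$$ -/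

import Mathlib

open MeasureTheory ProbabilityTheory
open scoped NNReal ENNReal

namespace RandomEnv

noncomputable section

/-- The total variation distance `sup_A |μ(A) - ν(A)|` over measurable sets `A`. -/
def dTV {G : Type*} [MeasurableSpace G] (μ ν : Measure G) : ℝ :=
  ⨆ A : {A : Set G // MeasurableSet A}, |μ.real A.1 - ν.real A.1|

/-- The set of couplings of `μ` and `ν`: probability measures on the product whose marginals
are `μ` and `ν`. -/
def couplings {G : Type*} [MeasurableSpace G] (μ ν : Measure G) : Set (Measure (G × G)) :=
  {π | IsProbabilityMeasure π ∧ π.map Prod.fst = μ ∧ π.map Prod.snd = ν}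

/-- The Wasserstein distance of order one for the metric `Δ(s, s') = min(|s - s'|, 1)` on a set
`F` of `ℝᵏ`, where `|·|` is the norm `N`. -/
def W1 {k : ℕ} (N : Seminorm ℝ (Fin k → ℝ)) {F : Set (Fin k → ℝ)} (μ ν : Measure F) : ℝ≥0∞ :=
  ⨅ π ∈ couplings μ ν,
    ∫⁻ z, ENNReal.ofReal (min (N ((z.1 : Fin k → ℝ) - (z.2 : Fin k → ℝ))) 1) ∂π

/-- `log⁺ u`, in `[0, ∞)`. -/
def logPos (u : ℝ≥0) : ℝ≥0∞ := (ENNReal.log (u : ℝ≥0∞)).toENNReal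

/-- `log⁻ u = max(-log u, 0)`, in `[0, ∞]`, with `log⁻ 0 = ∞`. -/
def logNeg (u : ℝ≥0) : ℝ≥0∞ := (-ENNReal.log (u : ℝ≥0∞)).toENNReal

/-- `𝔼 log⁺ Z < ∞`. -/
def LogPosIntegrable {Ω : Type*} [MeasurableSpace Ω] (P : Measure Ω) (Z : Ω → ℝ≥0) : Prop :=
  ∫⁻ ω, logPos (Z ω) ∂P < ∞

/-- `𝔼 log⁺ Z < ∞` and `𝔼 log Z < 0`, where `𝔼 log Z = 𝔼 log⁺ Z - 𝔼 log⁻ Z ∈ [-∞, ∞)`. -/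
def NegLogMean {Ω : Type*} [MeasurableSpace Ω] (P : Measure Ω) (Z : Ω → ℝ≥0) : Prop :=
  LogPosIntegrable P Z ∧ ∫⁻ ω, logPos (Z ω) ∂P < ∫⁻ ω, logNeg (Z ω) ∂P

/-- `X` is a stationary and ergodic process indexed by `ℤ`: its law on the path space is invariant
and ergodic under the shift. -/
def IsStationaryErgodic {Ω S : Type*} [MeasurableSpace Ω] [MeasurableSpace S]
    (P : Measure Ω) (X : ℤ → Ω → S) : Prop :=
  (∀ t, Measurable (X t)) ∧
    Ergodic (fun (x : ℤ → S) (t : ℤ) => x (t + 1)) (P.map (fun ω t => X t ω))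

/-- The ingredients of an observation-driven model with observations in `E`, latent states in `F`
and covariates in `L`: the probability kernel `p(dy | s)` and the measurable map `f(s, y, x)`. -/
structure ObsModel {g k d : ℕ} (E : Set (Fin g → ℝ)) (F : Set (Fin k → ℝ))
    (L : Set (Fin d → ℝ)) where
  p : Kernel F E
  markov_p : IsMarkovKernel p
  f : F → E → L → F
  measurable_f : Measurable (fun z : F × E × L => f z.1 z.2.1 z.2.2)

section Model

variable {g k d : ℕ} {E : Set (Fin g → ℝ)} {F : Set (Fin k → ℝ)} {L : Set (Fin d → ℝ)}

/-- The kernel `P_x` on `F`: `P_x(s, ·)` is the image of `p(· | s)` under `y ↦ f(s, y, x)`. -/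
def ObsModel.P (m : ObsModel E F L) (x : L) : Kernel F F :=
  (Kernel.id ×ₖ m.p).map (fun z : F × E => m.f z.1 z.2 x)

theorem ObsModel.P_apply (m : ObsModel E F L) (x : L) (s : F) :
    m.P x s = (m.p s).map (fun y => m.f s y x) := by
  haveI := m.markov_p
  have h1 : Measurable (fun z : F × E => m.f z.1 z.2 x) :=
    m.measurable_f.comp (measurable_fst.prodMk (measurable_snd.prodMk measurable_const))
  rw [ObsModel.P, Kernel.map_apply _ h1, Kernel.prod_apply, Kernel.id_apply,
    Measure.dirac_prod, Measure.map_map h1 measurable_prodMk_left]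
  rfl

/-- The forward iterates `δ_s P_{x_0} ⋯ P_{x_{n-1}}` along the environment `x`. -/
def ObsModel.forward (m : ObsModel E F L) (x : ℤ → L) (s : F) : ℕ → Measure F
  | 0 => Measure.dirac s
  | n + 1 => (m.forward x s n).bind (m.P (x n))

/-- Assumption A1: semi-contraction of `f` in its first argument. -/
structure A1 {Ω : Type*} [MeasurableSpace Ω] (P : Measure Ω) (X : ℤ → Ω → L)
    (m : ObsModel E F L) (N : Seminorm ℝ (Fin k → ℝ)) (κ : L → ℝ≥0) : Prop where
  norm_definite : ∀ v, N v = 0 → v = 0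
  measurable_κ : Measurable κ
  log_κ : NegLogMean P (fun ω => κ (X 0 ω))
  contraction : ∀ (y : E) (s s' : F) (x : L),
    N ((m.f s y x : Fin k → ℝ) - (m.f s' y x : Fin k → ℝ)) ≤
      κ x * N ((s : Fin k → ℝ) - (s' : Fin k → ℝ))

/-- Assumption A2: the drift condition. -/
structure A2 {Ω : Type*} [MeasurableSpace Ω] (P : Measure Ω) (X : ℤ → Ω → L)
    (m : ObsModel E F L) (N : Seminorm ℝ (Fin k → ℝ)) (γ δ : L → ℝ≥0) (V : F → ℝ≥0) (α : ℝ) :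
    Prop where
  measurable_γ : Measurable γ
  measurable_δ : Measurable δ
  measurable_V : Measurable V
  log_δ : LogPosIntegrable P (fun ω => δ (X 0 ω))
  log_γ : NegLogMean P (fun ω => γ (X 0 ω))
  V_ge : ∀ s : F, N (s : Fin k → ℝ) ^ α ≤ V s
  drift : ∀ (s : F) (x : L), ∫⁻ s', (V s' : ℝ≥0∞) ∂(m.P x s) ≤ γ x * V s + δ x

/-- Assumption A3: control of the total variation distance. -/
def A3 (m : ObsModel E F L) (N : Seminorm ℝ (Fin k → ℝ)) (φ : Polynomial ℝ) : Prop :=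
  ∀ s s' : F, dTV (m.p s) (m.p s') ≤
    1 - Real.exp (-φ.eval (N ((s : Fin k → ℝ) - (s' : Fin k → ℝ))))

end Model

/-! The environment functionals; `a`, `b` below are sequences such as `a t = γ(X_t(ω))`. -/

/-- `∑_{i ≥ 0} a_{t-1} ⋯ a_{t-i} b_{t-i-1}`. -/
def backwardSum (a b : ℤ → ℝ≥0) (t : ℤ) : ℝ≥0∞ :=
  ∑' i : ℕ, (((∏ j ∈ Finset.range i, a (t - 1 - j)) * b (t - 1 - i) : ℝ≥0) : ℝ≥0∞)

/-- `sup_{j ≥ h} a_{t-1} ⋯ a_{t-j}`. -/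
def backwardSup (h : ℕ) (a : ℤ → ℝ≥0) (t : ℤ) : ℝ≥0∞ :=
  ⨆ j ≥ h, ((∏ i ∈ Finset.range j, a (t - 1 - i) : ℝ≥0) : ℝ≥0∞)

/-- `∑_{s ≥ 0} φ(a_{t+s} ⋯ a_t)`. -/
def forwardSum (φ : Polynomial ℝ) (a : ℤ → ℝ≥0) (t : ℤ) : ℝ≥0∞ :=
  ∑' s : ℕ, ENNReal.ofReal (φ.eval ((∏ i ∈ Finset.range (s + 1), a (t + i) : ℝ≥0) : ℝ))

/-- `t` is a good time of the environment, for the sequences `κ_t`, `γ_t`, `δ_t`: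
`W_t⁽¹⁾ ≤ C`, `W_t⁽²⁾ ≤ 1 - 1/C`, `W_t⁽³⁾ ≤ 1 - 1/C` and `W_t⁽⁴⁾ ≤ C`. -/
def IsGoodTime (C : ℝ) (h : ℕ) (φ : Polynomial ℝ) (κ γ δ : ℤ → ℝ≥0) (t : ℤ) : Prop :=
  backwardSum γ δ t ≤ ENNReal.ofReal C ∧
  backwardSup h γ t ≤ ENNReal.ofReal (1 - 1 / C) ∧
  backwardSup h κ t ≤ ENNReal.ofReal (1 - 1 / C) ∧
  forwardSum φ κ t ≤ ENNReal.ofReal C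

/-- `τ_0 = 0`, and `τ_{i+1}` is the first good time `t` with `t - τ_i > h`
(`⊤` if there is none). -/
def goodTime (h : ℕ) (good : ℤ → Prop) : ℕ → ℕ∞
  | 0 => 0
  | i + 1 => sInf {t : ℕ∞ | ∃ r : ℕ, t = r ∧ goodTime h good i + h < r ∧ good r}

/-- `M_n = sup {i ≥ 0 : τ_i ≤ n}`. -/
def goodCount (h : ℕ) (good : ℤ → Prop) (n : ℕ) : ℕ :=
  sSup {i : ℕ | goodTime h good i ≤ n}

/-- The set in the definition of `goodCount` is bounded, so that its supremum is a maximum. -/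
theorem le_goodTime (h : ℕ) (good : ℤ → Prop) (i : ℕ) : (i : ℕ∞) ≤ goodTime h good i := by
  induction i with
  | zero => simp [goodTime]
  | succ i ih =>
    refine le_sInf ?_
    rintro t ⟨r, rfl, hr, -⟩
    have h1 : (i : ℕ∞) < r := lt_of_le_of_lt (ih.trans le_self_add) hr
    have h2 : i < r := by exact_mod_cast h1
    exact_mod_cast h2

end

end RandomEnv

/-! The estimate is pathwise: fix one environment and run the chains from `s` and `s'` together,
coupling their observations maximally at each step (`exists_maximal_coupling`). Let `D` be the
distance of the two states and `W` the sum of their values of `V`. By A3 the observations agree with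
probability at least `exp (-φ D)`, and then A1 multiplies `D` by at most `κ t`; by A2, `W` obeys a
drift inequality. `CoupledChain` keeps only these facts, and 𝒲₁ at time `n` is at most the mean of
`min 1 D`.

The good times make this uniform. Started at a good time, the contraction never fails with
probability at least `exp (-(D + D ^ deg φ) (φ 1 + C))`, since `∑ φ (κ_t ⋯ κ_{t+s}) ≤ C`. Up to a
later good time at distance at least `h`, the mean of `W` becomes at most `(1 - 1/C) W + 2 C`, and
products of `κ` are at most `1 - 1/C`.

A weak Harris argument follows (`exists_harris_step`): over a block of `k` good times the mean of
`√(min 1 (D/η) (1 + β W))` shrinks by `√ρ`. If `D < η`, a failure has probability linear in `D`, so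
the truncated distance contracts; if `D ≥ η` and `W` is moderate, `D` is bounded and falls to `η/2`
with a definite probability; if `W` is large, the drift suffices. Iterating over about `M_n / k`
blocks gives a rate geometric in `M_n`, hence in `√M_n`. -/

namespace RandomEnv

/-! ### Measurable maximal couplings -/

/-- Two Markov kernels split into a common part and remainders, whose mass is at most the
total variation distance. -/
theorem exists_common_part {A B : Type*} [MeasurableSpace A] [MeasurableSpace B]
    [MeasurableSpace.CountableOrCountablyGenerated A B]
    (κ η : Kernel A B) [IsMarkovKernel κ] [IsMarkovKernel η] :
    ∃ μ r₁ r₂ : Kernel A B, IsFiniteKernel μ ∧ IsFiniteKernel r₁ ∧ IsFiniteKernel r₂ ∧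
      κ = μ + r₁ ∧ η = μ + r₂ ∧ (∀ a, r₁ a Set.univ = r₂ a Set.univ) ∧
      ∀ a, r₁ a Set.univ ≤ ENNReal.ofReal (dTV (κ a) (η a)) := by
  -- `κ + η` dominates both kernels, and the kernel densities are jointly measurable; the common
  -- part has density `min f g`.
  set l : Kernel A B := κ + η with hl
  set f : A → B → ℝ≥0∞ := Kernel.rnDeriv κ l with hf
  set g : A → B → ℝ≥0∞ := Kernel.rnDeriv η l with hg
  have mf : Measurable (Function.uncurry f) := Kernel.measurable_rnDeriv κ l
  have mg : Measurable (Function.uncurry g) := Kernel.measurable_rnDeriv η l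
  have hκ : l.withDensity f = κ := by
    ext1 a
    refine Kernel.withDensity_rnDeriv_eq (Measure.absolutelyContinuous_of_le ?_)
    simpa [hl] using Measure.le_add_right (le_refl (κ a))
  have hη : l.withDensity g = η := by
    ext1 a
    refine Kernel.withDensity_rnDeriv_eq (Measure.absolutelyContinuous_of_le ?_)
    simpa [hl] using Measure.le_add_left (le_refl (η a))
  have mh : Measurable (Function.uncurry fun a b => min (f a b) (g a b)) := mf.min mg
  have m1 : Measurable (Function.uncurry fun a b => f a b - g a b) := mf.sub mg
  have m2 : Measurable (Function.uncurry fun a b => g a b - f a b) := mg.sub mf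
  have e1 : κ = l.withDensity (fun a b => min (f a b) (g a b))
      + l.withDensity (fun a b => f a b - g a b) := by
    rw [← Kernel.withDensity_add_right mh m1]
    refine hκ.symm.trans ?_
    congr 1
    ext a b
    simp only [Pi.add_apply]
    rcases le_total (f a b) (g a b) with h | h
    · simp [h, tsub_eq_zero_of_le h]
    · rw [min_eq_right h, add_tsub_cancel_of_le h]
  have e2 : η = l.withDensity (fun a b => min (f a b) (g a b))
      + l.withDensity (fun a b => g a b - f a b) := by
    rw [← Kernel.withDensity_add_right mh m2]
    refine hη.symm.trans ?_
    congr 1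
    ext a b
    simp only [Pi.add_apply]
    rcases le_total (f a b) (g a b) with h | h
    · rw [min_eq_left h, add_tsub_cancel_of_le h]
    · simp [h, tsub_eq_zero_of_le h]
  set μ := l.withDensity (fun a b => min (f a b) (g a b))
  set r₁ := l.withDensity (fun a b => f a b - g a b) with hr₁
  set r₂ := l.withDensity (fun a b => g a b - f a b) with hr₂
  have le_μ : μ ≤ κ := fun a => by rw [e1]; simpa using Measure.le_add_right (le_refl (μ a))
  have le_r₁ : r₁ ≤ κ := fun a => by rw [e1]; simpa using Measure.le_add_left (le_refl (r₁ a))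
  have le_r₂ : r₂ ≤ η := fun a => by rw [e2]; simpa using Measure.le_add_left (le_refl (r₂ a))
  have fμ : IsFiniteKernel μ := isFiniteKernel_of_le le_μ
  have fr₁ : IsFiniteKernel r₁ := isFiniteKernel_of_le le_r₁
  have fr₂ : IsFiniteKernel r₂ := isFiniteKernel_of_le le_r₂
  refine ⟨μ, r₁, r₂, fμ, fr₁, fr₂, e1, e2, fun a => ?_, fun a => ?_⟩
  · have h1 : κ a Set.univ = μ a Set.univ + r₁ a Set.univ := by
      conv_lhs => rw [e1]
      simp
    have h2 : η a Set.univ = μ a Set.univ + r₂ a Set.univ := by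
      conv_lhs => rw [e2]
      simp
    rw [measure_univ] at h1 h2
    exact (ENNReal.add_right_inj (measure_ne_top (μ a) _)).1 (h1.symm.trans h2)
  -- `r₁` lives on `S` and `r₂` vanishes there, so testing the total variation on `S` gives the mass
  -- of `r₁`.
  · set S : Set B := {b | g a b ≤ f a b} with hS
    have mS : MeasurableSet S :=
      measurableSet_le (mg.comp measurable_prodMk_left) (mf.comp measurable_prodMk_left)
    have h1 : r₁ a Sᶜ = 0 := by
      rw [hr₁, Kernel.withDensity_apply' _ m1, setLIntegral_congr_fun mS.compl (g := 0)]
      · simp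
      · intro b hb
        simp only [hS, Set.mem_compl_iff, Set.mem_ofPred_eq, not_le] at hb
        simpa using tsub_eq_zero_of_le hb.le
    have h2 : r₂ a S = 0 := by
      rw [hr₂, Kernel.withDensity_apply' _ m2, setLIntegral_congr_fun mS (g := 0)]
      · simp
      · intro b hb
        simpa using tsub_eq_zero_of_le hb
    have h3 : r₁ a Set.univ = r₁ a S := by
      rw [← measure_add_measure_compl mS, h1, add_zero]
    have hd : (r₁ a).real S = (κ a).real S - (η a).real S := by
      have a1 : (κ a).real S = (μ a).real S + (r₁ a).real S := by
        conv_lhs => rw [e1]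
        simp [measureReal_add_apply]
      have a2 : (η a).real S = (μ a).real S + (r₂ a).real S := by
        conv_lhs => rw [e2]
        simp [measureReal_add_apply]
      have a3 : (r₂ a).real S = 0 := by simp [measureReal_def, h2]
      linarith
    rw [h3, ← ENNReal.ofReal_toReal (measure_ne_top (r₁ a) S)]
    refine ENNReal.ofReal_le_ofReal ?_
    change (r₁ a).real S ≤ _
    rw [hd]
    refine (le_abs_self _).trans ?_
    refine le_ciSup (f := fun A : {A : Set B // MeasurableSet A} =>
      |(κ a).real A.1 - (η a).real A.1|) ⟨1, ?_⟩ ⟨S, mS⟩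
    rintro _ ⟨T, rfl⟩
    have b1 : (κ a).real T.1 ≤ 1 := measureReal_le_one
    have b2 : (η a).real T.1 ≤ 1 := measureReal_le_one
    exact abs_sub_le_iff.2 ⟨by linarith [measureReal_nonneg (μ := η a) (s := T.1)],
      by linarith [measureReal_nonneg (μ := κ a) (s := T.1)]⟩

/-- Maximal couplings of two Markov kernels can be chosen measurably. -/
theorem exists_maximal_coupling {A B : Type*} [MeasurableSpace A] [MeasurableSpace B]
    [MeasurableSpace.CountableOrCountablyGenerated A B] [MeasurableEq B]
    (κ η : Kernel A B) [IsMarkovKernel κ] [IsMarkovKernel η] :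
    ∃ ξ : Kernel A (B × B), IsMarkovKernel ξ ∧ ξ.map Prod.fst = κ ∧ ξ.map Prod.snd = η ∧
      ∀ a, ENNReal.ofReal (1 - dTV (κ a) (η a)) ≤ ξ a (Set.diagonal B) := by
  obtain ⟨μ, r₁, r₂, _, _, _, e1, e2, hr, hd⟩ := exists_common_part κ η
  have mw : Measurable (Function.uncurry fun (a : A) (_ : B × B) => (r₁ a Set.univ)⁻¹) :=
    ((r₁.measurable_coe MeasurableSet.univ).comp measurable_fst).inv
  have mdiag : Measurable fun b : B => (b, b) := measurable_id.prodMk measurable_id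
  -- The common part goes on the diagonal, the remainders are made independent and renormalised. If
  -- their mass is `0` the weight is `⊤`, but it multiplies the zero measure.
  set ξ : Kernel A (B × B) := μ.map (fun b => (b, b))
    + (r₁ ×ₖ r₂).withDensity (fun a _ => (r₁ a Set.univ)⁻¹) with hξ
  have hξa : ∀ a, ξ a = (μ a).map (fun b => (b, b))
      + (r₁ a Set.univ)⁻¹ • (r₁ a).prod (r₂ a) := by
    intro a
    rw [hξ, _root_.add_apply, Kernel.map_apply _ mdiag, Kernel.withDensity_apply _ mw,
      withDensity_const, Kernel.prod_apply]
  have key1 : ∀ a, (r₁ a Set.univ)⁻¹ • (r₁ a Set.univ) • r₂ a = r₂ a := by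
    intro a
    by_cases h0 : r₁ a Set.univ = 0
    · have : r₂ a = 0 := Measure.measure_univ_eq_zero.1 (by rw [← hr, h0])
      simp [this]
    · rw [smul_smul, ENNReal.inv_mul_cancel h0 (measure_ne_top _ _), one_smul]
  have key2 : ∀ a, (r₁ a Set.univ)⁻¹ • (r₂ a Set.univ) • r₁ a = r₁ a := by
    intro a
    by_cases h0 : r₁ a Set.univ = 0
    · have : r₁ a = 0 := Measure.measure_univ_eq_zero.1 h0
      simp [this]
    · rw [smul_smul, ← hr, ENNReal.inv_mul_cancel h0 (measure_ne_top _ _), one_smul]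
  have hfst : ξ.map Prod.fst = κ := by
    ext1 a
    rw [Kernel.map_apply _ measurable_fst, hξa, Measure.map_add _ _ measurable_fst,
      Measure.map_map measurable_fst mdiag, Measure.map_smul, Measure.map_fst_prod, key2]
    conv_rhs => rw [e1]
    simp [Function.comp_def]
  have hsnd : ξ.map Prod.snd = η := by
    ext1 a
    rw [Kernel.map_apply _ measurable_snd, hξa, Measure.map_add _ _ measurable_snd,
      Measure.map_map measurable_snd mdiag, Measure.map_smul, Measure.map_snd_prod, key1]
    conv_rhs => rw [e2]
    simp [Function.comp_def]
  refine ⟨ξ, ⟨fun a => ⟨?_⟩⟩, hfst, hsnd, fun a => ?_⟩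
  · rw [← measure_univ (μ := κ a), ← hfst, Kernel.map_apply' _ measurable_fst _ .univ,
      Set.preimage_univ]
  · have h1 : (1 : ℝ≥0∞) = μ a Set.univ + r₁ a Set.univ := by
      rw [← measure_univ (μ := κ a)]
      conv_lhs => rw [e1]
      simp
    have h2 : μ a Set.univ ≤ ξ a (Set.diagonal B) := by
      rw [hξa, Measure.add_apply, Measure.map_apply mdiag measurableSet_diagonal]
      have : (fun b : B => (b, b)) ⁻¹' Set.diagonal B = Set.univ := by ext; simp
      rw [this]
      exact le_self_add
    refine le_trans ?_ h2
    have h3 : μ a Set.univ = 1 - r₁ a Set.univ :=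
      ENNReal.eq_sub_of_add_eq (measure_ne_top _ _) h1.symm
    have hnn : 0 ≤ dTV (κ a) (η a) := Real.iSup_nonneg fun _ => abs_nonneg _
    rw [h3, ENNReal.ofReal_sub _ hnn, ENNReal.ofReal_one]
    exact tsub_le_tsub_left (hd a) 1

/-! ### Inhomogeneous chains with a size and a Lyapunov function -/

/-- The transition kernel from time `r` to time `r + m` of the inhomogeneous Markov chain whose
step at time `t` is `Q t`. -/
noncomputable def iterKernel {Z : Type*} [MeasurableSpace Z] (Q : ℕ → Kernel Z Z) (r : ℕ) :
    ℕ → Kernel Z Z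
  | 0 => Kernel.id
  | m + 1 => Q (r + m) ∘ₖ iterKernel Q r m

theorem iterKernel_add {Z : Type*} [MeasurableSpace Z] (Q : ℕ → Kernel Z Z) (r m l : ℕ) :
    iterKernel Q r (m + l) = iterKernel Q (r + m) l ∘ₖ iterKernel Q r m := by
  induction l with
  | zero => simp [iterKernel]
  | succ l ih =>
    rw [← add_assoc, iterKernel, ih, iterKernel, Kernel.comp_assoc, add_assoc]

instance isMarkovKernel_iterKernel {Z : Type*} [MeasurableSpace Z] (Q : ℕ → Kernel Z Z)
    [∀ t, IsMarkovKernel (Q t)] (r m : ℕ) : IsMarkovKernel (iterKernel Q r m) := by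
  induction m with
  | zero => rw [iterKernel]; infer_instance
  | succ m ih => rw [iterKernel]; infer_instance

/-- A Markov chain with a size function `D` which, at a state of size `r`, is multiplied at most by
`κ t` with probability at least `exp (-φ r)`, and with a Lyapunov function `W`. -/
structure CoupledChain {Z : Type*} [MeasurableSpace Z] (Q : ℕ → Kernel Z Z) (D W : Z → ℝ≥0)
    (κ γ δ : ℤ → ℝ≥0) (φ : Polynomial ℝ) : Prop where
  markov : ∀ t, IsMarkovKernel (Q t)
  measurable_D : Measurable D
  measurable_W : Measurable W
  contract : ∀ (t : ℕ) (z : Z),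
    ENNReal.ofReal (Real.exp (-φ.eval (D z : ℝ))) ≤ Q t z {z' | D z' ≤ κ t * D z}
  drift : ∀ (t : ℕ) (z : Z), ∫⁻ z', (W z' : ℝ≥0∞) ∂(Q t z) ≤ γ t * W z + 2 * δ t

/-! ### Polynomials with nonnegative coefficients and no constant term -/

section Polynomial

variable {φ : Polynomial ℝ}

theorem eval_mono_of_coeff_nonneg (hφ : ∀ j, 0 ≤ φ.coeff j) {a b : ℝ} (ha : 0 ≤ a) (hab : a ≤ b) :
    φ.eval a ≤ φ.eval b := by
  rw [Polynomial.eval_eq_sum_range, Polynomial.eval_eq_sum_range]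
  exact Finset.sum_le_sum fun i _ => mul_le_mul_of_nonneg_left (pow_le_pow_left₀ ha hab i) (hφ i)

theorem eval_nonneg_of_coeff_nonneg (hφ : ∀ j, 0 ≤ φ.coeff j) {a : ℝ} (ha : 0 ≤ a) :
    0 ≤ φ.eval a := by
  rw [Polynomial.eval_eq_sum_range]
  exact Finset.sum_nonneg fun i _ => mul_nonneg (hφ i) (pow_nonneg ha i)

theorem one_le_natDegree_of_coeff_zero (h0 : φ ≠ 0) (hz : φ.coeff 0 = 0) : 1 ≤ φ.natDegree := by
  by_contra h
  have h1 : φ.natDegree = 0 := by omega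
  rw [Polynomial.eq_C_of_natDegree_eq_zero h1, hz] at h0
  simp at h0

theorem pow_le_add_pow {r : ℝ} (hr : 0 ≤ r) {i d : ℕ} (h1 : 1 ≤ i) (hd : i ≤ d) :
    r ^ i ≤ r + r ^ d := by
  rcases le_total r 1 with h | h
  · have := pow_le_of_le_one hr h (n := i) (by omega)
    have := pow_nonneg hr d
    linarith
  · have := pow_le_pow_right₀ h hd
    linarith

/-- Separates the size `r` of the state from the product `u` of the environment, so that the sum in
`IsGoodTime`, which does not involve the state, controls every initial size. The linear term makes
the factor vanish as `r → 0`. -/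
theorem eval_mul_le (hz : φ.coeff 0 = 0) (hφ : ∀ j, 0 ≤ φ.coeff j) {u r : ℝ} (hu : 0 ≤ u)
    (hr : 0 ≤ r) : φ.eval (u * r) ≤ (r + r ^ φ.natDegree) * φ.eval u := by
  rw [Polynomial.eval_eq_sum_range, Polynomial.eval_eq_sum_range, Finset.mul_sum]
  refine Finset.sum_le_sum fun i hi => ?_
  rcases Nat.eq_zero_or_pos i with rfl | hi0
  · simp [hz]
  · have hid : i ≤ φ.natDegree := by simpa [Nat.lt_succ_iff] using hi
    rw [mul_pow]
    have := mul_le_mul_of_nonneg_left (pow_le_add_pow hr hi0 hid)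
      (mul_nonneg (hφ i) (pow_nonneg hu i))
    linarith

/-- A polynomial with nonnegative coefficients and no constant term is bounded below, so that
its sublevel sets are explicitly bounded. -/
theorem le_of_eval_le (h0 : φ ≠ 0) (hz : φ.coeff 0 = 0) (hφ : ∀ j, 0 ≤ φ.coeff j) {u C : ℝ}
    (hu : 0 ≤ u) (hC : 0 ≤ C) (h : φ.eval u ≤ C) : u ≤ 1 + C / φ.leadingCoeff := by
  have hl : 0 < φ.leadingCoeff :=
    lt_of_le_of_ne (hφ _) (Ne.symm (Polynomial.leadingCoeff_ne_zero.2 h0))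
  rcases le_total u 1 with h1 | h1
  · have := div_nonneg hC hl.le
    linarith
  · have h2 : φ.leadingCoeff * u ≤ C := by
      refine le_trans ?_ h
      rw [Polynomial.eval_eq_sum_range]
      refine le_trans ?_ (Finset.single_le_sum (f := fun i => φ.coeff i * u ^ i)
        (fun i _ => mul_nonneg (hφ i) (pow_nonneg hu i)) (Finset.self_mem_range_succ _))
      exact mul_le_mul_of_nonneg_left
        (le_self_pow₀ h1 (by have := one_le_natDegree_of_coeff_zero h0 hz; omega)) hl.le
    have : u ≤ C / φ.leadingCoeff := by rw [le_div_iff₀ hl]; linarith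
    linarith

end Polynomial

/-! ### The sequence of good times -/

section GoodTimes

/-- The counted good times up to time `n`, as a sequence of natural numbers; they are at least `h`
apart. -/
theorem exists_good_sequence (h : ℕ) (good : ℤ → Prop) (n : ℕ) :
    ∃ σ : ℕ → ℕ, σ 0 = 0 ∧ σ (goodCount h good n) ≤ n ∧
      ∀ i < goodCount h good n, good (σ (i + 1)) ∧ σ i + h ≤ σ (i + 1) := by
  set M := goodCount h good n with hM
  have hmem : goodTime h good M ≤ n := by
    refine Nat.sSup_mem (s := {i : ℕ | goodTime h good i ≤ n}) ⟨0, by simp [goodTime]⟩ ⟨n, ?_⟩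
    intro i hi
    exact_mod_cast (le_goodTime h good i).trans hi
  have step : ∀ i, goodTime h good (i + 1) ≠ ⊤ → ∃ r : ℕ, goodTime h good (i + 1) = r ∧
      goodTime h good i + h < r ∧ good r := by
    intro i hi
    rw [goodTime] at hi ⊢
    refine csInf_mem (s := {t : ℕ∞ | ∃ r : ℕ, t = r ∧ goodTime h good i + h < r ∧ good r}) ?_
    by_contra hne
    rw [Set.not_nonempty_iff_eq_empty] at hne
    rw [hne] at hi
    simp at hi
  -- Finiteness descends from the index `M`, because each good time exceeds its predecessor.
  have fin : ∀ j ≤ M, goodTime h good (M - j) ≠ ⊤ := by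
    intro j
    induction j with
    | zero => intro _; exact ne_top_of_le_ne_top (ENat.natCast_ne_top n) hmem
    | succ j ih =>
      intro hj
      have e : M - j = (M - (j + 1)) + 1 := by omega
      obtain ⟨r, -, hr, -⟩ := step (M - (j + 1)) (e ▸ ih (by omega))
      exact ne_top_of_le_ne_top (ENat.natCast_ne_top r) (le_self_add.trans hr.le)
  have fin' : ∀ i ≤ M, goodTime h good i ≠ ⊤ := by
    intro i hi
    have := fin (M - i) (by omega)
    rwa [Nat.sub_sub_self hi] at this
  refine ⟨fun i => (goodTime h good i).toNat, by simp [goodTime], ?_, fun i hi => ?_⟩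
  · have := ENat.natCast_toNat (fin' M le_rfl)
    rw [← this] at hmem
    exact_mod_cast hmem
  · obtain ⟨r, hr1, hr2, hr3⟩ := step i (fin' _ hi)
    have h1 := ENat.natCast_toNat (fin' i hi.le)
    rw [← h1] at hr2
    simp only [hr1, ENat.toNat_natCast]
    exact ⟨hr3, by exact_mod_cast hr2.le⟩

end GoodTimes

/-! ### Contraction and drift between good times -/

namespace CoupledChain

variable {Z : Type*} [MeasurableSpace Z] {Q : ℕ → Kernel Z Z} {D W : Z → ℝ≥0}
  {κ γ δ : ℤ → ℝ≥0} {φ : Polynomial ℝ}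

/-- As long as every step succeeds, `D` stays below the product of the `κ`, and `φ` is monotone, so
by the Markov property the success probabilities multiply. -/
theorem iterKernel_contract (H : CoupledChain Q D W κ γ δ φ) (hφ : ∀ j, 0 ≤ φ.coeff j)
    (t m : ℕ) (z : Z) :
    ENNReal.ofReal (Real.exp
        (-∑ j ∈ Finset.range m, φ.eval (((∏ i ∈ Finset.range j, κ (t + i)) * D z : ℝ≥0) : ℝ))) ≤
      iterKernel Q t m z {z' | D z' ≤ (∏ i ∈ Finset.range m, κ (t + i)) * D z} := by
  have := H.markov
  induction m with
  | zero =>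
    simp [iterKernel, Kernel.id_apply]
  | succ m ih =>
    set r : ℝ≥0 := (∏ i ∈ Finset.range m, κ (t + i)) * D z with hr
    have e : (∏ i ∈ Finset.range (m + 1), κ (t + i)) * D z = κ ((t + m : ℕ) : ℤ) * r := by
      rw [Finset.prod_range_succ, hr]; push_cast; ring
    have ms : ∀ a : ℝ≥0, MeasurableSet {z' | D z' ≤ a} := fun a =>
      measurableSet_le H.measurable_D measurable_const
    rw [e, Finset.sum_range_succ, neg_add, Real.exp_add, ENNReal.ofReal_mul (Real.exp_pos _).le,
      iterKernel, Kernel.comp_apply' _ _ _ (ms _), mul_comm]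
    calc ENNReal.ofReal (Real.exp (-φ.eval (r : ℝ))) * _
        ≤ ENNReal.ofReal (Real.exp (-φ.eval (r : ℝ))) * iterKernel Q t m z {z' | D z' ≤ r} := by
          gcongr
      _ = ∫⁻ z' in {z' | D z' ≤ r}, ENNReal.ofReal (Real.exp (-φ.eval (r : ℝ)))
            ∂(iterKernel Q t m z) := by rw [setLIntegral_const]
      _ ≤ ∫⁻ z' in {z' | D z' ≤ r}, Q (t + m) z' {z'' | D z'' ≤ κ ((t + m : ℕ) : ℤ) * r}
            ∂(iterKernel Q t m z) := by
          refine setLIntegral_mono' (ms _) fun z' hz' => ?_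
          refine le_trans (ENNReal.ofReal_le_ofReal (Real.exp_le_exp.2 (neg_le_neg ?_)))
            ((H.contract (t + m) z').trans (measure_mono fun z'' hz'' => ?_))
          · exact eval_mono_of_coeff_nonneg hφ (D z').2 (by exact_mod_cast hz')
          · exact le_trans hz'' (mul_le_mul_right (show D z' ≤ r from hz') _)
      _ ≤ _ := setLIntegral_le_lintegral _ _

/-- Indices run backwards from the final time `t`, to match `backwardSum` and `backwardSup`; the
induction peels off the last step. -/
theorem iterKernel_drift (H : CoupledChain Q D W κ γ δ φ) (r m : ℕ) (z : Z) (t : ℤ)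
    (ht : t = r + m) :
    ∫⁻ z', (W z' : ℝ≥0∞) ∂(iterKernel Q r m z) ≤
      ((∏ i ∈ Finset.range m, γ (t - 1 - i) : ℝ≥0) : ℝ≥0∞) * W z +
      2 * ∑ i ∈ Finset.range m,
        (((∏ j ∈ Finset.range i, γ (t - 1 - j)) * δ (t - 1 - i) : ℝ≥0) : ℝ≥0∞) := by
  have := H.markov
  have mW : Measurable fun z => (W z : ℝ≥0∞) := H.measurable_W.coe_nnreal_ennreal
  induction m generalizing t with
  | zero => simp [iterKernel, Kernel.id_apply, lintegral_dirac' _ mW]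
  | succ m ih =>
    have ih' := ih (t - 1) (by rw [ht]; push_cast; ring)
    have et : ((r + m : ℕ) : ℤ) = t - 1 := by rw [ht]; push_cast; ring
    rw [iterKernel, Kernel.lintegral_comp _ _ _ mW]
    calc ∫⁻ z', ∫⁻ z'', (W z'' : ℝ≥0∞) ∂(Q (r + m) z') ∂(iterKernel Q r m z)
        ≤ ∫⁻ z', (γ (t - 1) * W z' + 2 * δ (t - 1) : ℝ≥0∞) ∂(iterKernel Q r m z) :=
          lintegral_mono fun z' => by rw [← et]; exact H.drift (r + m) z'
      _ = γ (t - 1) * ∫⁻ z', (W z' : ℝ≥0∞) ∂(iterKernel Q r m z) + 2 * δ (t - 1) := by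
          rw [lintegral_add_right _ measurable_const, lintegral_const_mul _ mW]
          simp
      _ ≤ γ (t - 1) * (((∏ i ∈ Finset.range m, γ (t - 1 - 1 - i) : ℝ≥0) : ℝ≥0∞) * W z +
            2 * ∑ i ∈ Finset.range m, (((∏ j ∈ Finset.range i, γ (t - 1 - 1 - j)) *
              δ (t - 1 - 1 - i) : ℝ≥0) : ℝ≥0∞)) + 2 * δ (t - 1) := by gcongr
      _ = _ := by
          have e1 : ∀ k, ∏ i ∈ Finset.range (k + 1), γ (t - 1 - i) =
              γ (t - 1) * ∏ i ∈ Finset.range k, γ (t - 1 - 1 - i) := by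
            intro k
            rw [Finset.prod_range_succ', mul_comm]
            congr 1
            · simp
            · exact Finset.prod_congr rfl fun i _ => by congr 1; push_cast; ring
          rw [Finset.sum_range_succ', e1]
          have e2 : ∀ i : ℕ, t - 1 - ((i + 1 : ℕ) : ℤ) = t - 1 - 1 - i := by
            intro i; push_cast; ring
          simp only [e1, e2, Finset.range_zero, Finset.prod_empty, one_mul, Nat.cast_zero, sub_zero,
            ENNReal.coe_mul, mul_assoc]
          rw [mul_add, mul_add, ← Finset.mul_sum]
          ring

variable {C : ℝ} {h : ℕ}

theorem lintegral_W_le_of_isGoodTime (H : CoupledChain Q D W κ γ δ φ) (hC : 1 < C) {r m : ℕ}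
    (hm : h ≤ m) (hg : IsGoodTime C h φ κ γ δ ((r + m : ℕ) : ℤ)) (z : Z) :
    ∫⁻ z', (W z' : ℝ≥0∞) ∂(iterKernel Q r m z) ≤
      ENNReal.ofReal ((1 - 1 / C) * W z + 2 * C) := by
  have hC0 : 0 < C := by linarith
  have hθ : 0 ≤ 1 - 1 / C := by rw [sub_nonneg, div_le_one hC0]; exact hC.le
  obtain ⟨h1, h2, -, -⟩ := hg
  refine (H.iterKernel_drift r m z ((r + m : ℕ) : ℤ) (by push_cast; rfl)).trans ?_
  rw [ENNReal.ofReal_add (by positivity) (by positivity), ENNReal.ofReal_mul hθ,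
    ENNReal.ofReal_mul (by norm_num), ENNReal.ofReal_coe_nnreal]
  gcongr
  · refine le_trans ?_ h2
    exact le_iSup₂_of_le m hm le_rfl
  · simp
  · exact (ENNReal.sum_le_tsum _).trans h1

theorem prod_κ_le_of_isGoodTime {κ γ δ : ℤ → ℝ≥0} {r m : ℕ} (hm : h ≤ m)
    (hC : 1 < C) (hg : IsGoodTime C h φ κ γ δ ((r + m : ℕ) : ℤ)) :
    ((∏ i ∈ Finset.range m, κ (r + i) : ℝ≥0) : ℝ) ≤ 1 - 1 / C := by
  have hC0 : 0 < C := by linarith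
  have hθ : 0 ≤ 1 - 1 / C := by rw [sub_nonneg, div_le_one hC0]; exact hC.le
  have h3 := hg.2.2.1
  have : ((∏ i ∈ Finset.range m, κ (((r + m : ℕ) : ℤ) - 1 - i) : ℝ≥0) : ℝ≥0∞) ≤
      ENNReal.ofReal (1 - 1 / C) := le_trans (le_iSup₂_of_le m hm le_rfl) h3
  have e : ∏ i ∈ Finset.range m, κ (((r + m : ℕ) : ℤ) - 1 - i) =
      ∏ i ∈ Finset.range m, κ (r + i) := by
    rw [← Finset.prod_range_reflect]
    refine Finset.prod_congr rfl fun i hi => ?_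
    have := Finset.mem_range.1 hi
    congr 1
    omega
  rw [e, ← ENNReal.ofReal_coe_nnreal] at this
  exact (ENNReal.ofReal_le_ofReal_iff hθ).1 this

theorem sum_eval_prod_le_of_isGoodTime {κ γ δ : ℤ → ℝ≥0} (hφ : ∀ j, 0 ≤ φ.coeff j) (hC : 1 < C)
    {t : ℤ} (hg : IsGoodTime C h φ κ γ δ t) (m : ℕ) :
    ∑ s ∈ Finset.range m, φ.eval ((∏ i ∈ Finset.range (s + 1), κ (t + i) : ℝ≥0) : ℝ) ≤ C := by
  have h4 := hg.2.2.2
  have := (ENNReal.sum_le_tsum (Finset.range m)).trans h4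
  rw [← ENNReal.ofReal_sum_of_nonneg
    (fun s _ => eval_nonneg_of_coeff_nonneg hφ (NNReal.coe_nonneg _))] at this
  exact (ENNReal.ofReal_le_ofReal_iff (by linarith)).1 this

/-- From a good time on, products of the `κ t` are bounded. -/
theorem prod_κ_le_of_isGoodTime_left {κ γ δ : ℤ → ℝ≥0} (h0 : φ ≠ 0) (hz : φ.coeff 0 = 0)
    (hφ : ∀ j, 0 ≤ φ.coeff j) (hC : 1 < C)
    {t : ℤ} (hg : IsGoodTime C h φ κ γ δ t) (m : ℕ) :
    ((∏ i ∈ Finset.range m, κ (t + i) : ℝ≥0) : ℝ) ≤ 1 + C / φ.leadingCoeff := by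
  have hl : 0 ≤ φ.leadingCoeff := hφ _
  rcases m with _ | m
  · have : 0 ≤ C / φ.leadingCoeff := by positivity
    simpa using this
  · refine le_of_eval_le h0 hz hφ (NNReal.coe_nonneg _) (by linarith) ?_
    refine le_trans ?_ (sum_eval_prod_le_of_isGoodTime hφ hC hg (m + 1))
    exact Finset.single_le_sum
      (f := fun s => φ.eval ((∏ i ∈ Finset.range (s + 1), κ (t + i) : ℝ≥0) : ℝ))
      (fun s _ => eval_nonneg_of_coeff_nonneg hφ (NNReal.coe_nonneg _)) (Finset.self_mem_range_succ m)

/-- From a good time on, the size is contracted forever with a probability bounded below. -/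
theorem contract_of_isGoodTime (H : CoupledChain Q D W κ γ δ φ) (hz : φ.coeff 0 = 0)
    (hφ : ∀ j, 0 ≤ φ.coeff j) (hC : 1 < C) {t : ℕ} (hg : IsGoodTime C h φ κ γ δ t) (m : ℕ) (z : Z) :
    ENNReal.ofReal (Real.exp (-((D z + (D z : ℝ) ^ φ.natDegree) * (φ.eval 1 + C)))) ≤
      iterKernel Q t m z {z' | D z' ≤ (∏ i ∈ Finset.range m, κ (t + i)) * D z} := by
  refine le_trans (ENNReal.ofReal_le_ofReal (Real.exp_le_exp.2 (neg_le_neg ?_)))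
    (H.iterKernel_contract hφ t m z)
  have hD : (0 : ℝ) ≤ D z := (D z).2
  have hD' : (0 : ℝ) ≤ D z + (D z : ℝ) ^ φ.natDegree := by positivity
  calc ∑ j ∈ Finset.range m, φ.eval (((∏ i ∈ Finset.range j, κ (t + i)) * D z : ℝ≥0) : ℝ)
      -- The extra summand allows the term `j = 0`, the source of `φ.eval 1`, to be split off for
      -- every `m`, including `0`.
      ≤ ∑ j ∈ Finset.range (m + 1),
          φ.eval (((∏ i ∈ Finset.range j, κ (t + i)) * D z : ℝ≥0) : ℝ) :=
        Finset.sum_le_sum_of_subset_of_nonneg (Finset.range_mono (Nat.le_succ m))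
          fun j _ _ => eval_nonneg_of_coeff_nonneg hφ (NNReal.coe_nonneg _)
    _ ≤ ∑ j ∈ Finset.range (m + 1), (D z + (D z : ℝ) ^ φ.natDegree) *
          φ.eval ((∏ i ∈ Finset.range j, κ (t + i) : ℝ≥0) : ℝ) :=
        Finset.sum_le_sum fun j _ => by
          rw [NNReal.coe_mul]
          exact eval_mul_le hz hφ (NNReal.coe_nonneg _) hD
    _ = (D z + (D z : ℝ) ^ φ.natDegree) * (φ.eval 1 + ∑ j ∈ Finset.range m,
          φ.eval ((∏ i ∈ Finset.range (j + 1), κ (t + i) : ℝ≥0) : ℝ)) := by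
        rw [← Finset.mul_sum, Finset.sum_range_succ']
        simp only [Finset.range_zero, Finset.prod_empty, NNReal.coe_one]
        ring
    _ ≤ _ := by
        have := sum_eval_prod_le_of_isGoodTime hφ hC hg m
        gcongr

end CoupledChain

/-! ### Tools for the weak Harris theorem -/

/-- Cauchy–Schwarz: the truncated distance and the Lyapunov function can be estimated separately. -/
theorem lintegral_sqrt_mul_le {Z : Type*} [MeasurableSpace Z] (π : Measure Z) {d w : Z → ℝ}
    (md : Measurable d) (mw : Measurable w) (hd : ∀ z, 0 ≤ d z) (hw : ∀ z, 0 ≤ w z) {A B : ℝ}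
    (hA : 0 ≤ A) (hdA : ∫⁻ z, ENNReal.ofReal (d z) ∂π ≤ ENNReal.ofReal A)
    (hwB : ∫⁻ z, ENNReal.ofReal (w z) ∂π ≤ ENNReal.ofReal B) :
    ∫⁻ z, ENNReal.ofReal (√(d z * w z)) ∂π ≤ ENNReal.ofReal (√(A * B)) := by
  have sq : ∀ x : ℝ, 0 ≤ x → ENNReal.ofReal (√x) ^ (2 : ℝ) = ENNReal.ofReal x := by
    intro x hx
    rw [ENNReal.ofReal_rpow_of_nonneg (Real.sqrt_nonneg _) (by norm_num)]
    congr 1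
    simp [Real.sq_sqrt hx]
  have sr : ∀ x : ℝ, ENNReal.ofReal (√x) = ENNReal.ofReal x ^ (1 / 2 : ℝ) := by
    intro x
    rcases le_total 0 x with hx | hx
    · rw [Real.sqrt_eq_rpow, ENNReal.ofReal_rpow_of_nonneg hx (by norm_num)]
    · rw [Real.sqrt_eq_zero_of_nonpos hx, ENNReal.ofReal_of_nonpos hx]
      simp
  have hold := ENNReal.lintegral_mul_le_Lp_mul_Lq π (p := 2) (q := 2)
    (by rw [Real.holderConjugate_iff]; norm_num)
    (f := fun z => ENNReal.ofReal (√(d z))) (g := fun z => ENNReal.ofReal (√(w z)))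
    (md.sqrt.ennreal_ofReal.aemeasurable) (mw.sqrt.ennreal_ofReal.aemeasurable)
  simp only [sq _ (hd _), sq _ (hw _), Pi.mul_apply] at hold
  calc ∫⁻ z, ENNReal.ofReal (√(d z * w z)) ∂π
      = ∫⁻ z, ENNReal.ofReal (√(d z)) * ENNReal.ofReal (√(w z)) ∂π :=
        lintegral_congr fun z => by
          rw [Real.sqrt_mul (hd z), ENNReal.ofReal_mul (Real.sqrt_nonneg _)]
    _ ≤ _ := hold
    _ ≤ ENNReal.ofReal A ^ (1 / 2 : ℝ) * ENNReal.ofReal B ^ (1 / 2 : ℝ) := by gcongr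
    _ = _ := by
      rw [← sr, ← sr, Real.sqrt_mul hA, ENNReal.ofReal_mul (Real.sqrt_nonneg _)]

theorem lintegral_le_of_le_measure {Z : Type*} [MeasurableSpace Z] (π : Measure Z)
    [IsProbabilityMeasure π] {f : Z → ℝ} {S : Set Z} (mS : MeasurableSet S) {b p : ℝ}
    (hb0 : 0 ≤ b) (hb1 : b ≤ 1) (hf : ∀ z, f z ≤ 1) (hfS : ∀ z ∈ S, f z ≤ b)
    (hp : ENNReal.ofReal p ≤ π S) :
    ∫⁻ z, ENNReal.ofReal (f z) ∂π ≤ ENNReal.ofReal (b * p + (1 - p)) := by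
  have hq : p ≤ π.real S := by
    rwa [measureReal_def, ← ENNReal.ofReal_le_iff_le_toReal (measure_ne_top _ _)]
  have hq1 : π.real S ≤ 1 := measureReal_le_one
  calc ∫⁻ z, ENNReal.ofReal (f z) ∂π
      = ∫⁻ z in S, ENNReal.ofReal (f z) ∂π + ∫⁻ z in Sᶜ, ENNReal.ofReal (f z) ∂π :=
        (lintegral_add_compl _ mS).symm
    _ ≤ ∫⁻ _ in S, ENNReal.ofReal b ∂π + ∫⁻ _ in Sᶜ, 1 ∂π := by
        refine add_le_add (setLIntegral_mono' mS fun z hz => ENNReal.ofReal_le_ofReal (hfS z hz))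
          (setLIntegral_mono' mS.compl fun z _ => ?_)
        simpa using hf z
    _ = ENNReal.ofReal (b * π.real S + (1 - π.real S)) := by
        rw [setLIntegral_const, setLIntegral_const, one_mul, ← ofReal_measureReal,
          ← ofReal_measureReal, probReal_compl_eq_one_sub mS, ← ENNReal.ofReal_mul hb0,
          ← ENNReal.ofReal_add (mul_nonneg hb0 measureReal_nonneg) (by linarith)]
    _ ≤ _ := ENNReal.ofReal_le_ofReal (by nlinarith)

/-- The constants of the weak Harris theorem. -/
theorem exists_harris_constants {θ e l : ℝ} (hθ0 : 0 ≤ θ) (hθ1 : θ < 1) (he0 : 0 < e) (he1 : e ≤ 1)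
    (hl : 0 < l) :
    ∃ β ρ : ℝ, 0 < β ∧ β ≤ 1 ∧ 0 < ρ ∧ ρ < 1 ∧
      (∀ d w : ℝ, 0 ≤ d → 0 ≤ w →
        (1 - e) * d * (1 + β * (θ * w + l)) ≤ ρ * (d * (1 + β * w))) ∧
      ∀ w : ℝ, 4 * l / (1 - θ) ≤ w → 1 + β * (θ * w + l) ≤ ρ * (1 + β * w) := by
  -- `β l ≤ e / 2` lets the gain `e` in the distance absorb the additive drift constant; `c` is the
  -- gain from the drift once `w ≥ 4 l / (1 - θ)`.
  set β := min 1 (e / (2 * l)) with hβ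
  set c := min ((1 - θ) / 4) (β * l) with hc
  have hβ0 : 0 < β := lt_min one_pos (by positivity)
  have hc0 : 0 < c := lt_min (by linarith) (by positivity)
  have hβl : β * l ≤ e / 2 := by
    have : β ≤ e / (2 * l) := min_le_right _ _
    rw [le_div_iff₀ (by positivity)] at this
    linarith
  have hc1 : c ≤ (1 - θ) / 4 := min_le_left _ _
  have hc2 : c ≤ β * l := min_le_right _ _
  refine ⟨β, max (1 - e / 2) (1 - c), hβ0, min_le_left _ _, lt_max_of_lt_left (by linarith),
    max_lt (by linarith) (by linarith), fun d w hd hw => ?_, fun w hw => ?_⟩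
  · have h1 : (1 - e) * (1 + β * (θ * w + l)) ≤ (1 - e / 2) * (1 + β * w) := by
      have hβw : 0 ≤ β * w := by positivity
      have h2 : 1 + β * (θ * w + l) ≤ 1 + e / 2 + β * w := by nlinarith
      have h3 := mul_le_mul_of_nonneg_left h2 (sub_nonneg.2 he1)
      nlinarith
    have hβw : 0 ≤ 1 + β * w := by positivity
    calc (1 - e) * d * (1 + β * (θ * w + l)) = (1 - e) * (1 + β * (θ * w + l)) * d := by ring
      _ ≤ (1 - e / 2) * (1 + β * w) * d := by gcongr
      _ ≤ max (1 - e / 2) (1 - c) * (1 + β * w) * d := by gcongr; exact le_max_left _ _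
      _ = _ := by ring
  · have hw' : 4 * l ≤ w * (1 - θ) := by rwa [div_le_iff₀ (by linarith)] at hw
    have hw0 : 0 ≤ w := le_trans (div_nonneg (by positivity) (by linarith)) hw
    have hβw : 0 ≤ β * w := by positivity
    have h1 : 1 + β * (θ * w + l) ≤ (1 - c) * (1 + β * w) := by
      have h2 := mul_le_mul_of_nonneg_left hw' hβ0.le
      have h3 := mul_le_mul_of_nonneg_right hc1 hβw
      nlinarith
    refine h1.trans ?_
    gcongr
    exact le_max_right _ _

/-- Products over blocks of consecutive good times. -/
theorem block_of_isGoodTime {C : ℝ} (hC : 1 < C) {h M : ℕ} {φ : Polynomial ℝ} {κ γ δ : ℤ → ℝ≥0}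
    {σ : ℕ → ℕ}
    (hσ : ∀ i < M, IsGoodTime C h φ κ γ δ (σ (i + 1)) ∧ σ i + h ≤ σ (i + 1))
    (a k : ℕ) (hk : a + k ≤ M) :
    ∃ m, σ (a + k) = σ a + m ∧
      ((∏ i ∈ Finset.range m, κ (σ a + i) : ℝ≥0) : ℝ) ≤ (1 - 1 / C) ^ k := by
  have hθ : 0 ≤ 1 - 1 / C := by rw [sub_nonneg, div_le_one (by linarith)]; exact hC.le
  induction k with
  | zero => exact ⟨0, by simp⟩
  | succ k ih =>
    obtain ⟨m, hm, hp⟩ := ih (by omega)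
    obtain ⟨hg, hs⟩ := hσ (a + k) (by omega)
    obtain ⟨l, hl⟩ := Nat.exists_eq_add_of_le hs
    have e : σ (a + (k + 1)) = σ (a + k) + (h + l) := by rw [← add_assoc, hl]; ring
    refine ⟨m + (h + l), by rw [e, hm]; ring, ?_⟩
    have hg' : IsGoodTime C h φ κ γ δ ((σ (a + k) + (h + l) : ℕ) : ℤ) := by
      rw [← e]; exact hg
    have hq := CoupledChain.prod_κ_le_of_isGoodTime (m := h + l) (by omega) hC hg'
    rw [Finset.prod_range_add, NNReal.coe_mul, pow_succ]
    refine mul_le_mul hp (le_trans (le_of_eq ?_) hq) (NNReal.coe_nonneg _) (by positivity)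
    congr 1
    refine Finset.prod_congr rfl fun i _ => ?_
    rw [hm]
    push_cast
    congr 1
    ring

/-! ### Weak Harris contraction and its iteration -/

namespace CoupledChain

variable {Z : Type*} [MeasurableSpace Z] {Q : ℕ → Kernel Z Z} {D W : Z → ℝ≥0}
  {κ γ δ : ℤ → ℝ≥0} {φ : Polynomial ℝ} {C : ℝ} {h : ℕ}

/-- The mean of the truncated size at scale `x`, after an attempted contraction. -/
theorem lintegral_min_le (H : CoupledChain Q D W κ γ δ φ) (hz : φ.coeff 0 = 0)
    (hφ : ∀ j, 0 ≤ φ.coeff j) (hC : 1 < C) {t : ℕ} (hg : IsGoodTime C h φ κ γ δ t) (m : ℕ) (z : Z)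
    {a b x : ℝ} (hx : 0 < x) (ha : ((∏ i ∈ Finset.range m, κ (t + i) : ℝ≥0) : ℝ) ≤ a)
    (hb0 : 0 ≤ b) (hb1 : b ≤ 1) (hab : a * D z ≤ b * x) :
    ∫⁻ z', ENNReal.ofReal (min 1 (D z' / x)) ∂(iterKernel Q t m z) ≤ ENNReal.ofReal
      (b * Real.exp (-((D z + (D z : ℝ) ^ φ.natDegree) * (φ.eval 1 + C))) +
        (1 - Real.exp (-((D z + (D z : ℝ) ^ φ.natDegree) * (φ.eval 1 + C))))) := by
  have := H.markov
  refine lintegral_le_of_le_measure _ (measurableSet_le H.measurable_D measurable_const) hb0 hb1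
    (fun _ => min_le_left _ _) (fun z' hz' => ?_) (H.contract_of_isGoodTime hz hφ hC hg m z)
  refine (min_le_right _ _).trans ?_
  rw [div_le_iff₀ hx]
  have h1 : (D z' : ℝ) ≤ ((∏ i ∈ Finset.range m, κ (t + i) : ℝ≥0) : ℝ) * D z := by
    exact_mod_cast hz'
  exact h1.trans ((mul_le_mul_of_nonneg_right ha (D z).2).trans hab)

end CoupledChain

/-- For small sizes the failure probability is linear in the size, hence dominated by the gain in `D
/ η` when `η` is small. -/
theorem one_sub_exp_le {r x : ℝ} {d : ℕ} (hd : 1 ≤ d) (hr0 : 0 ≤ r) (hr1 : r ≤ 1) (hx : 0 ≤ x) :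
    1 - Real.exp (-((r + r ^ d) * x)) ≤ 2 * x * r := by
  have h1 := Real.add_one_le_exp (-((r + r ^ d) * x))
  have h2 : r ^ d ≤ r := pow_le_of_le_one hr0 hr1 (by omega)
  nlinarith

namespace CoupledChain

/-- The weak Harris theorem for the chain observed at good times. -/
theorem exists_harris_step {C : ℝ} (hC : 1 < C) {α : ℝ} (hα : 0 < α) {φ : Polynomial ℝ}
    (h0 : φ ≠ 0) (hz : φ.coeff 0 = 0) (hφ : ∀ j, 0 ≤ φ.coeff j) :
    ∃ η β ρ : ℝ, ∃ k : ℕ, 0 < η ∧ η < 1 ∧ 0 < β ∧ β ≤ 1 ∧ 0 < ρ ∧ ρ < 1 ∧ 1 ≤ k ∧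
      ∀ {Z : Type} [MeasurableSpace Z] {Q : ℕ → Kernel Z Z} {D W : Z → ℝ≥0}
        {κ γ δ : ℤ → ℝ≥0} {h t m : ℕ}, CoupledChain Q D W κ γ δ φ →
      (∀ z, (D z : ℝ) ≤ 2 * (W z : ℝ) ^ (1 / α)) →
      IsGoodTime C h φ κ γ δ t → IsGoodTime C h φ κ γ δ ((t + m : ℕ) : ℤ) → h ≤ m →
      ((∏ i ∈ Finset.range m, κ (t + i) : ℝ≥0) : ℝ) ≤ (1 - 1 / C) ^ k → ∀ z,
      ∫⁻ z', ENNReal.ofReal (√(min 1 (D z' / η) * (1 + β * W z'))) ∂(iterKernel Q t m z) ≤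
        ENNReal.ofReal (√ρ * √(min 1 (D z / η) * (1 + β * W z))) := by
  have hC0 : 0 < C := by linarith
  set θ : ℝ := 1 - 1 / C with hθ
  have hθ0 : 0 ≤ θ := by rw [hθ, sub_nonneg, div_le_one hC0]; exact hC.le
  have hθ1 : θ < 1 := by rw [hθ]; linarith [one_div_pos.2 hC0]
  set K : ℝ := φ.eval 1 + C with hK
  have hK0 : 0 < K := by
    have := eval_nonneg_of_coeff_nonneg hφ zero_le_one
    linarith
  have hdeg := one_le_natDegree_of_coeff_zero h0 hz
  -- Chosen so that failures, of probability at most `2 K D`, cost at most half of the contraction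
  -- `1 - θ` of `D / η`.
  set η : ℝ := (1 - θ) / (4 * K + 1) with hη
  have hη0 : 0 < η := div_pos (by linarith) (by linarith)
  have hη1 : η < 1 := by rw [hη, div_lt_one (by linarith)]; linarith
  have hηK : 2 * K * η ≤ (1 - θ) / 2 := by
    have : η * (4 * K + 1) = 1 - θ := div_mul_cancel₀ _ (by positivity)
    nlinarith
  -- Above `R` the drift alone contracts; below it `D ≤ r₀`, and contraction succeeds with
  -- probability at least `p₀`.
  set R : ℝ := 4 * (2 * C) / (1 - θ) with hR
  have hR0 : 0 ≤ R := div_nonneg (by linarith) (by linarith)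
  set r₀ : ℝ := 2 * R ^ (1 / α) with hr₀
  have hr₀0 : 0 ≤ r₀ := by positivity
  set p₀ : ℝ := Real.exp (-((r₀ + r₀ ^ φ.natDegree) * K)) with hp₀
  have hp₀0 : 0 < p₀ := Real.exp_pos _
  have hp₀1 : p₀ ≤ 1 := Real.exp_le_one_iff.2 (by rw [neg_nonpos]; positivity)
  set e : ℝ := min ((1 - θ) / 2) (p₀ / 2) with he
  have he0 : 0 < e := lt_min (by linarith) (by linarith)
  have he1 : e ≤ 1 := (min_le_right _ _).trans (by linarith)
  obtain ⟨β, ρ, hβ0, hβ1, hρ0, hρ1, hh1, hh2⟩ :=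
    exists_harris_constants hθ0 hθ1 he0 he1 (l := 2 * C) (by linarith)
  -- Enough good times to bring a size `r₀` down to `η / 2`.
  obtain ⟨k₀, hk₀⟩ := exists_pow_lt_of_lt_one (show 0 < η / (2 * (r₀ + 1)) by positivity) hθ1
  refine ⟨η, β, ρ, k₀ + 1, hη0, hη1, hβ0, hβ1, hρ0, hρ1, Nat.le_add_left _ _, ?_⟩
  intro Z _ Q D W κ γ δ h t m H hDW hg hg' hm hprod z
  have hk1 : θ ^ (k₀ + 1) ≤ θ := pow_le_of_le_one hθ0 hθ1.le (by omega)
  have hk2 : θ ^ (k₀ + 1) * r₀ ≤ 1 / 2 * η := by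
    have h1 : θ ^ (k₀ + 1) ≤ θ ^ k₀ := pow_le_pow_of_le_one hθ0 hθ1.le (by omega)
    have h2 : θ ^ (k₀ + 1) ≤ η / (2 * (r₀ + 1)) := h1.trans hk₀.le
    rw [le_div_iff₀ (by positivity)] at h2
    have h3 : 0 ≤ θ ^ (k₀ + 1) := by positivity
    nlinarith
  have hD0 : (0 : ℝ) ≤ D z := (D z).2
  have hW0 : (0 : ℝ) ≤ W z := (W z).2
  have hd0 : ∀ z, 0 ≤ min 1 ((D z : ℝ) / η) := fun z => le_min zero_le_one (by positivity)
  have hw0 : ∀ z, 0 ≤ 1 + β * (W z : ℝ) := fun z => by positivity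
  have mD : Measurable fun z => min 1 ((D z : ℝ) / η) :=
    measurable_const.min (H.measurable_D.coe_nnreal_real.div_const η)
  have mW : Measurable fun z => 1 + β * (W z : ℝ) :=
    measurable_const.add (H.measurable_W.coe_nnreal_real.const_mul β)
  have hwB : ∫⁻ z', ENNReal.ofReal (1 + β * (W z' : ℝ)) ∂(iterKernel Q t m z) ≤
      ENNReal.ofReal (1 + β * (θ * W z + 2 * C)) := by
    have := H.markov
    have e1 : ∀ z', ENNReal.ofReal (1 + β * (W z' : ℝ)) = 1 + ENNReal.ofReal β * W z' := by
      intro z'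
      rw [ENNReal.ofReal_add zero_le_one (by positivity), ENNReal.ofReal_mul hβ0.le,
        ENNReal.ofReal_one, ENNReal.ofReal_coe_nnreal]
    simp only [e1]
    rw [lintegral_add_left measurable_const,
      lintegral_const_mul _ H.measurable_W.coe_nnreal_ennreal,
      ENNReal.ofReal_add zero_le_one (by positivity), ENNReal.ofReal_mul hβ0.le]
    simp only [lintegral_const, measure_univ, mul_one, ENNReal.ofReal_one]
    gcongr
    exact H.lintegral_W_le_of_isGoodTime hC hm hg' z
  have finish : ∀ A : ℝ, 0 ≤ A →
      ∫⁻ z', ENNReal.ofReal (min 1 ((D z' : ℝ) / η)) ∂(iterKernel Q t m z) ≤ ENNReal.ofReal A →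
      A * (1 + β * (θ * W z + 2 * C)) ≤ ρ * (min 1 ((D z : ℝ) / η) * (1 + β * W z)) →
      ∫⁻ z', ENNReal.ofReal (√(min 1 (D z' / η) * (1 + β * W z'))) ∂(iterKernel Q t m z) ≤
        ENNReal.ofReal (√ρ * √(min 1 (D z / η) * (1 + β * W z))) := by
    intro A hA hdA hle
    refine (lintegral_sqrt_mul_le _ mD mW hd0 hw0 hA hdA hwB).trans
      (ENNReal.ofReal_le_ofReal ?_)
    rw [← Real.sqrt_mul hρ0.le]
    exact Real.sqrt_le_sqrt hle
  set p : ℝ := Real.exp (-((D z + (D z : ℝ) ^ φ.natDegree) * K)) with hp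
  have hp0 : 0 < p := Real.exp_pos _
  by_cases hs : (D z : ℝ) < η
  · have hd : min 1 ((D z : ℝ) / η) = D z / η :=
      min_eq_right ((div_le_one hη0).2 hs.le)
    have hdn : 0 ≤ (D z : ℝ) / η := by positivity
    have hD1 : (D z : ℝ) / η ≤ 1 := (div_le_one hη0).2 hs.le
    have hDη : (D z : ℝ) / η * η = D z := div_mul_cancel₀ _ hη0.ne'
    have hp1 : p ≤ 1 := Real.exp_le_one_iff.2 (by rw [neg_nonpos]; positivity)
    have key : ∫⁻ z', ENNReal.ofReal (min 1 ((D z' : ℝ) / η)) ∂(iterKernel Q t m z) ≤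
        ENNReal.ofReal ((1 - e) * (D z / η)) := by
      refine (H.lintegral_min_le hz hφ hC hg m z (a := θ) (b := θ * (D z / η)) hη0
        (hprod.trans hk1) (by positivity) (by nlinarith) (by rw [mul_assoc, hDη])).trans
        (ENNReal.ofReal_le_ofReal ?_)
      have h1 : 1 - p ≤ 2 * K * D z := one_sub_exp_le hdeg hD0 (hs.le.trans hη1.le) hK0.le
      have h2 : e ≤ (1 - θ) / 2 := min_le_left _ _
      have h3 : 2 * K * D z ≤ (1 - θ) / 2 * (D z / η) := by
        calc 2 * K * (D z : ℝ) = 2 * K * (D z / η * η) := by rw [hDη]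
          _ = 2 * K * η * (D z / η) := by ring
          _ ≤ _ := by gcongr
      have h4 : θ * (D z / η) * p ≤ θ * (D z / η) := mul_le_of_le_one_right (by positivity) hp1
      have h5 : e * (D z / η) ≤ (1 - θ) / 2 * (D z / η) := by gcongr
      change θ * (D z / η) * p + (1 - p) ≤ _
      linarith
    refine finish _ (mul_nonneg (by linarith) hdn) key ?_
    rw [hd]
    exact hh1 _ _ hdn hW0
  · have hd : min 1 ((D z : ℝ) / η) = 1 :=
      min_eq_left ((one_le_div hη0).2 (not_lt.1 hs))
    by_cases hWR : (W z : ℝ) ≤ R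
    · have hDr : (D z : ℝ) ≤ r₀ := (hDW z).trans (by
        rw [hr₀]
        have := Real.rpow_le_rpow hW0 hWR (show 0 ≤ 1 / α by positivity)
        linarith)
      have key : ∫⁻ z', ENNReal.ofReal (min 1 ((D z' : ℝ) / η)) ∂(iterKernel Q t m z) ≤
          ENNReal.ofReal (1 - e) := by
        refine (H.lintegral_min_le hz hφ hC hg m z (a := θ ^ (k₀ + 1)) (b := 1 / 2) hη0
          hprod (by norm_num) (by norm_num) (le_trans (by gcongr) hk2)).trans
          (ENNReal.ofReal_le_ofReal ?_)
        have h1 : p₀ ≤ p := by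
          refine Real.exp_le_exp.2 (neg_le_neg ?_)
          gcongr
        have h2 : e ≤ p₀ / 2 := min_le_right _ _
        change 1 / 2 * p + (1 - p) ≤ _
        linarith
      refine finish _ (by linarith) key ?_
      rw [hd]
      simpa using hh1 1 _ zero_le_one hW0
    · have := H.markov
      refine finish 1 zero_le_one ?_ ?_
      · calc ∫⁻ z', ENNReal.ofReal (min 1 ((D z' : ℝ) / η)) ∂(iterKernel Q t m z)
            ≤ ∫⁻ _, 1 ∂(iterKernel Q t m z) :=
              lintegral_mono fun z' => by simp
          _ = _ := by simp
      · rw [hd, one_mul, one_mul]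
        exact hh2 _ (not_le.1 hWR).le

/-- The path splits into an initial piece up to the first counted good time, where only the drift is
used, blocks of `k` good times, each gaining `√ρ`, and a final piece up to `n`, where at most a
constant factor is lost. -/
theorem exists_lintegral_min_le {C : ℝ} (hC : 1 < C) {α : ℝ} (hα : 0 < α) {φ : Polynomial ℝ}
    (h0 : φ ≠ 0) (hz : φ.coeff 0 = 0) (hφ : ∀ j, 0 ≤ φ.coeff j) :
    ∃ Cbar ρbar : ℝ, 0 < Cbar ∧ 0 < ρbar ∧ ρbar < 1 ∧
      ∀ {Z : Type} [MeasurableSpace Z] {Q : ℕ → Kernel Z Z} {D W : Z → ℝ≥0}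
        {κ γ δ : ℤ → ℝ≥0} (h n : ℕ), CoupledChain Q D W κ γ δ φ →
      (∀ z, (D z : ℝ) ≤ 2 * (W z : ℝ) ^ (1 / α)) → ∀ z,
      ∫⁻ z', ENNReal.ofReal (min 1 (D z')) ∂(iterKernel Q 0 n z) ≤
        ENNReal.ofReal (Cbar * (1 + W z) *
          ρbar ^ √(goodCount h (IsGoodTime C h φ κ γ δ) n)) := by
  obtain ⟨η, β, ρ, k, hη0, hη1, hβ0, hβ1, hρ0, hρ1, hk, step⟩ :=
    exists_harris_step hC hα h0 hz hφ
  have hC0 : 0 < C := by linarith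
  have hθ0 : 0 ≤ 1 - 1 / C := by rw [sub_nonneg, div_le_one hC0]; exact hC.le
  have hl : 0 ≤ φ.leadingCoeff := hφ _
  set K : ℝ := φ.eval 1 + C with hK
  have hK0 : 0 < K := by
    have := eval_nonneg_of_coeff_nonneg hφ zero_le_one
    linarith
  set B : ℝ := 1 + C / φ.leadingCoeff with hB
  have hB0 : 0 < B := by positivity
  set s : ℝ := √ρ with hs
  have hs0 : 0 < s := Real.sqrt_pos.2 hρ0
  have hs1 : s < 1 := by rw [hs, Real.sqrt_lt' one_pos]; linarith
  have hk0 : (0 : ℝ) < k := by exact_mod_cast hk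
  set A : ℝ := (B + 2 * K + 1) * (1 + 2 * C) * s⁻¹ with hA
  have hA0 : 0 < A := by positivity
  refine ⟨1 + A, s ^ (1 / (k : ℝ)), by positivity, by positivity,
    Real.rpow_lt_one hs0.le hs1 (by positivity), ?_⟩
  intro Z _ Q D W κ γ δ h n H hDW z
  have := H.markov
  have hW0 : ∀ z, (0 : ℝ) ≤ W z := fun z => (W z).2
  obtain ⟨σ, hσ0, hσn, hσ⟩ := exists_good_sequence h (IsGoodTime C h φ κ γ δ) n
  set M := goodCount h (IsGoodTime C h φ κ γ δ) n with hM
  set G : Z → ℝ≥0∞ := fun z => ENNReal.ofReal (√(min 1 (D z / η) * (1 + β * W z))) with hG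
  have mG : Measurable G :=
    ((measurable_const.min (H.measurable_D.coe_nnreal_real.div_const η)).mul
      (measurable_const.add (H.measurable_W.coe_nnreal_real.const_mul β))).sqrt.ennreal_ofReal
  have hd0 : ∀ z, 0 ≤ min 1 ((D z : ℝ) / η) := fun z => le_min zero_le_one (by positivity)
  rcases Nat.eq_zero_or_pos M with hM0 | hM0
  · calc ∫⁻ z', ENNReal.ofReal (min 1 (D z' : ℝ)) ∂(iterKernel Q 0 n z)
        ≤ ∫⁻ _, 1 ∂(iterKernel Q 0 n z) := lintegral_mono fun z' => by simp
      _ = ENNReal.ofReal 1 := by simp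
      _ ≤ _ := ENNReal.ofReal_le_ofReal (by
          rw [hM0]
          simp only [Nat.cast_zero, Real.sqrt_zero, Real.rpow_zero, mul_one]
          nlinarith [hW0 z])
  have hinit : ∫⁻ z', G z' ∂(iterKernel Q 0 (σ 1) z) ≤
      ENNReal.ofReal (1 + 2 * C + W z) := by
    obtain ⟨hg, hh⟩ := hσ 0 hM0
    rw [hσ0] at hh
    calc ∫⁻ z', G z' ∂(iterKernel Q 0 (σ 1) z)
        ≤ ∫⁻ z', (1 + W z' : ℝ≥0∞) ∂(iterKernel Q 0 (σ 1) z) := by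
          refine lintegral_mono fun z' => ?_
          rw [← ENNReal.ofReal_coe_nnreal, ← ENNReal.ofReal_one,
            ← ENNReal.ofReal_add zero_le_one (hW0 z')]
          refine ENNReal.ofReal_le_ofReal (Real.sqrt_le_iff.2 ⟨by have := hW0 z'; positivity, ?_⟩)
          have hW := hW0 z'
          have h1 : min 1 ((D z' : ℝ) / η) ≤ 1 := min_le_left _ _
          have h2 : 1 + β * (W z' : ℝ) ≤ 1 + W z' := by nlinarith
          calc min 1 ((D z' : ℝ) / η) * (1 + β * W z') ≤ 1 * (1 + W z') := by gcongr
            _ ≤ _ := by nlinarith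
      _ = 1 + ∫⁻ z', (W z' : ℝ≥0∞) ∂(iterKernel Q 0 (σ 1) z) := by
          rw [lintegral_add_left measurable_const]; simp
      _ ≤ 1 + ENNReal.ofReal ((1 - 1 / C) * W z + 2 * C) := by
          gcongr
          exact H.lintegral_W_le_of_isGoodTime hC (by omega) (by simpa using hg) z
      _ ≤ _ := by
          have hW := hW0 z
          rw [← ENNReal.ofReal_one, ← ENNReal.ofReal_add zero_le_one (by positivity)]
          refine ENNReal.ofReal_le_ofReal ?_
          have : 0 ≤ 1 / C := by positivity
          nlinarith
  have hblock : ∀ j, 1 + j * k ≤ M → ∫⁻ z', G z' ∂(iterKernel Q 0 (σ (1 + j * k)) z) ≤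
      ENNReal.ofReal (s ^ j * (1 + 2 * C + W z)) := by
    intro j
    induction j with
    | zero => intro _; simpa using hinit
    | succ j ih =>
      intro hj
      have hj' : 1 + j * k + k ≤ M := by rw [add_mul] at hj; omega
      obtain ⟨m, hm, hp⟩ := block_of_isGoodTime hC hσ (1 + j * k) k hj'
      have e1 : 1 + (j + 1) * k = 1 + j * k + k := by ring
      have hgt : IsGoodTime C h φ κ γ δ (σ (1 + j * k)) := by
        rw [add_comm]; exact (hσ (j * k) (by omega)).1
      have hgt' : IsGoodTime C h φ κ γ δ ((σ (1 + j * k) + m : ℕ) : ℤ) := by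
        rw [← hm, show 1 + j * k + k = (j * k + k) + 1 by ring]
        exact (hσ (j * k + k) (by omega)).1
      have hhm : h ≤ m := by
        obtain ⟨m₁, hm₁, -⟩ := block_of_isGoodTime hC hσ (1 + j * k + 1) (k - 1) (by omega)
        have := (hσ (1 + j * k) (by omega)).2
        rw [show 1 + j * k + 1 + (k - 1) = 1 + j * k + k by omega] at hm₁
        omega
      rw [e1, hm, iterKernel_add, zero_add, Kernel.lintegral_comp _ _ _ mG]
      calc ∫⁻ y, ∫⁻ z', G z' ∂(iterKernel Q (σ (1 + j * k)) m y)
              ∂(iterKernel Q 0 (σ (1 + j * k)) z)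
          ≤ ∫⁻ y, ENNReal.ofReal s * G y ∂(iterKernel Q 0 (σ (1 + j * k)) z) := by
            refine lintegral_mono fun y => ?_
            rw [hG, ← ENNReal.ofReal_mul hs0.le]
            exact step H hDW hgt hgt' hhm hp y
        _ = ENNReal.ofReal s * ∫⁻ y, G y ∂(iterKernel Q 0 (σ (1 + j * k)) z) :=
            lintegral_const_mul _ mG
        _ ≤ ENNReal.ofReal s * ENNReal.ofReal (s ^ j * (1 + 2 * C + W z)) := by
            gcongr
            exact ih (by omega)
        _ = _ := by
            rw [← ENNReal.ofReal_mul hs0.le]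
            congr 1
            ring
  -- Time `n` need not be good, but after a good time products of `κ` are at most `B`: small sizes
  -- grow at most by `B` unless a failure occurs, and for other sizes the right side is at least
  -- `1`.
  have hlast : ∀ (t : ℕ) (l : ℕ) (y : Z), IsGoodTime C h φ κ γ δ t →
      ∫⁻ z', ENNReal.ofReal (min 1 (D z' : ℝ)) ∂(iterKernel Q t l y) ≤
        ENNReal.ofReal (B + 2 * K + 1) * G y := by
    intro t l y hg
    have hD0 : (0 : ℝ) ≤ D y := (D y).2
    have hGd : ENNReal.ofReal (min 1 ((D y : ℝ) / η)) ≤ G y := by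
      refine ENNReal.ofReal_le_ofReal (Real.le_sqrt_of_sq_le ?_)
      rw [sq]
      refine mul_le_mul_of_nonneg_left ((min_le_left _ _).trans ?_) (hd0 y)
      have := hW0 y
      have : 0 ≤ β * (W y : ℝ) := by positivity
      linarith
    refine le_trans ?_ (mul_le_mul_right hGd _)
    rw [← ENNReal.ofReal_mul (by positivity)]
    have htriv : ∫⁻ z', ENNReal.ofReal (min 1 (D z' : ℝ)) ∂(iterKernel Q t l y) ≤
        ENNReal.ofReal 1 := by
      calc ∫⁻ z', ENNReal.ofReal (min 1 (D z' : ℝ)) ∂(iterKernel Q t l y)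
          ≤ ∫⁻ _, 1 ∂(iterKernel Q t l y) := lintegral_mono fun z' => by simp
        _ = _ := by simp
    by_cases hs : (D y : ℝ) < η ∧ B * D y ≤ 1
    · have hp : Real.exp (-((D y + (D y : ℝ) ^ φ.natDegree) * K)) ≤ 1 :=
        Real.exp_le_one_iff.2 (by rw [neg_nonpos]; positivity)
      have hmain := H.lintegral_min_le hz hφ hC hg l y (a := B) (b := B * D y) one_pos
        (prod_κ_le_of_isGoodTime_left h0 hz hφ hC hg l) (by positivity) hs.2 (by simp)
      simp only [div_one] at hmain
      refine hmain.trans (ENNReal.ofReal_le_ofReal ?_)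
      have h1 := one_sub_exp_le (one_le_natDegree_of_coeff_zero h0 hz) hD0
        (hs.1.le.trans hη1.le) hK0.le
      have h2 : B * D y * Real.exp (-((D y + (D y : ℝ) ^ φ.natDegree) * K)) ≤ B * D y :=
        mul_le_of_le_one_right (by positivity) hp
      have h3 : (D y : ℝ) ≤ min 1 ((D y : ℝ) / η) :=
        le_min (hs.1.le.trans hη1.le) (le_div_self hD0 hη0 hη1.le)
      have h4 : (B + 2 * K) * D y ≤ (B + 2 * K) * min 1 ((D y : ℝ) / η) := by gcongr
      have := hd0 y
      linarith
    · refine htriv.trans (ENNReal.ofReal_le_ofReal ?_)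
      rcases not_and_or.1 hs with h1 | h1
      · rw [min_eq_left ((one_le_div hη0).2 (not_lt.1 h1))]
        linarith
      · have h3 : min 1 (D y : ℝ) ≤ min 1 ((D y : ℝ) / η) :=
          min_le_min_left _ (le_div_self hD0 hη0 hη1.le)
        rcases le_total (D y : ℝ) 1 with h2 | h2
        · rw [min_eq_right h2] at h3
          have h4 : B * D y ≤ B * min 1 ((D y : ℝ) / η) := by gcongr
          have := hd0 y
          nlinarith
        · rw [min_eq_left h2] at h3
          nlinarith
  -- The number of complete blocks after the first good time; the incomplete one costs the factor
  -- `s⁻¹`.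
  set j := (M - 1) / k with hj
  have hjk : 1 + j * k ≤ M := by
    have := Nat.div_mul_le_self (M - 1) k
    rw [← hj] at this
    omega
  have hjM : M ≤ (j + 1) * k := by
    have := Nat.lt_div_mul_add (a := M - 1) (b := k) (by omega)
    rw [← hj] at this
    rw [add_mul]
    omega
  have hgt : IsGoodTime C h φ κ γ δ (σ (1 + j * k)) := by
    rw [add_comm]; exact (hσ (j * k) (by omega)).1
  have hσle : σ (1 + j * k) ≤ n := by
    obtain ⟨m, hm, -⟩ := block_of_isGoodTime hC hσ (1 + j * k) (M - (1 + j * k)) (by omega)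
    rw [show 1 + j * k + (M - (1 + j * k)) = M by omega] at hm
    omega
  obtain ⟨l, hl⟩ := Nat.exists_eq_add_of_le hσle
  have mmin : Measurable fun z' => ENNReal.ofReal (min 1 (D z' : ℝ)) :=
    (measurable_const.min H.measurable_D.coe_nnreal_real).ennreal_ofReal
  rw [hl, iterKernel_add, zero_add, Kernel.lintegral_comp _ _ _ mmin]
  calc ∫⁻ y, ∫⁻ z', ENNReal.ofReal (min 1 (D z' : ℝ)) ∂(iterKernel Q (σ (1 + j * k)) l y)
          ∂(iterKernel Q 0 (σ (1 + j * k)) z)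
      ≤ ∫⁻ y, ENNReal.ofReal (B + 2 * K + 1) * G y ∂(iterKernel Q 0 (σ (1 + j * k)) z) :=
        lintegral_mono fun y => hlast _ l y hgt
    _ = ENNReal.ofReal (B + 2 * K + 1) * ∫⁻ y, G y ∂(iterKernel Q 0 (σ (1 + j * k)) z) :=
        lintegral_const_mul _ mG
    _ ≤ ENNReal.ofReal (B + 2 * K + 1) * ENNReal.ofReal (s ^ j * (1 + 2 * C + W z)) := by
        gcongr
        exact hblock j hjk
    _ ≤ _ := by
        rw [← ENNReal.ofReal_mul (by positivity)]
        refine ENNReal.ofReal_le_ofReal ?_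
        have hW := hW0 z
        have h1 : s ^ j ≤ s⁻¹ * (s ^ (1 / (k : ℝ))) ^ √(M : ℝ) := by
          rw [← Real.rpow_mul hs0.le, ← Real.rpow_natCast, ← Real.rpow_neg_one,
            ← Real.rpow_add hs0]
          refine Real.rpow_le_rpow_of_exponent_ge hs0 hs1.le ?_
          have h2 : √(M : ℝ) ≤ M := by
            have hM1 : (1 : ℝ) ≤ M := by exact_mod_cast hM0
            rw [Real.sqrt_le_left (by positivity)]
            nlinarith
          have h3 : (M : ℝ) ≤ (j + 1) * k := by exact_mod_cast hjM
          have h4 : 1 / (k : ℝ) * √(M : ℝ) ≤ j + 1 := by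
            rw [one_div_mul_eq_div, div_le_iff₀ hk0]
            linarith
          linarith
        have h5 : 1 + 2 * C + (W z : ℝ) ≤ (1 + 2 * C) * (1 + W z) := by nlinarith
        have h6 : 0 ≤ (s ^ (1 / (k : ℝ))) ^ √(M : ℝ) := by positivity
        calc (B + 2 * K + 1) * (s ^ j * (1 + 2 * C + W z))
            ≤ (B + 2 * K + 1) * (s⁻¹ * (s ^ (1 / (k : ℝ))) ^ √(M : ℝ) *
                ((1 + 2 * C) * (1 + W z))) := by gcongr
          _ = A * (1 + W z) * (s ^ (1 / (k : ℝ))) ^ √(M : ℝ) := by rw [hA]; ring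
          _ ≤ _ := by gcongr; linarith

end CoupledChain

/-! ### The coupled observation-driven chains -/

section Model

variable {g k d : ℕ} {E : Set (Fin g → ℝ)} {F : Set (Fin k → ℝ)} {L : Set (Fin d → ℝ)}

/-- A chain in `Z` whose steps are mapped by `f` to the kernels `P_x` is mapped to the forward
iterates. -/
theorem map_iterKernel_eq_forward {Z : Type*} [MeasurableSpace Z] (m : ObsModel E F L) (x : ℤ → L)
    {Q : ℕ → Kernel Z Z} {f : Z → F} (hf : Measurable f)
    (hQ : ∀ t : ℕ, (Q t).map f = (m.P (x t)).comap f hf) (n : ℕ) (z : Z) :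
    (iterKernel Q 0 n z).map f = m.forward x (f z) n := by
  induction n with
  | zero => rw [iterKernel, Kernel.id_apply, Measure.map_dirac' hf, ObsModel.forward]
  | succ n ih =>
    rw [ObsModel.forward, ← ih, iterKernel, zero_add, ← Kernel.map_apply _ hf, Kernel.map_comp, hQ,
      ← Kernel.comp_map, Kernel.comp_apply, Kernel.map_apply _ hf]

/-- The coupled kernels on `F × F`: the observations are maximally coupled. -/
theorem ObsModel.exists_coupled_kernel (m : ObsModel E F L) :
    ∃ Q : L → Kernel (F × F) (F × F), ∀ x, IsMarkovKernel (Q x) ∧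
      (Q x).map Prod.fst = (m.P x).comap Prod.fst measurable_fst ∧
      (Q x).map Prod.snd = (m.P x).comap Prod.snd measurable_snd ∧
      ∀ (z : F × F) (S : Set (F × F)), MeasurableSet S →
        (∀ y, (m.f z.1 y x, m.f z.2 y x) ∈ S) →
        ENNReal.ofReal (1 - dTV (m.p z.1) (m.p z.2)) ≤ Q x z S := by
  have := m.markov_p
  obtain ⟨ξ, hξ, h1, h2, h3⟩ := exists_maximal_coupling
    (m.p.comap (Prod.fst : F × F → F) measurable_fst)
    (m.p.comap (Prod.snd : F × F → F) measurable_snd)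
  have mf : ∀ (x : L) (s : F), Measurable (fun y => m.f s y x) := fun x s =>
    m.measurable_f.comp (measurable_const.prodMk (measurable_id.prodMk measurable_const))
  have mz : ∀ (x : L) (z : F × F),
      Measurable (fun y : E × E => (m.f z.1 y.1 x, m.f z.2 y.2 x)) := fun x z =>
    ((mf x z.1).comp measurable_fst).prodMk ((mf x z.2).comp measurable_snd)
  have mu : ∀ x : L, Measurable
      (fun u : (F × F) × (E × E) => (m.f u.1.1 u.2.1 x, m.f u.1.2 u.2.2 x)) := fun x =>
    (m.measurable_f.comp (measurable_fst.fst.prodMk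
      (measurable_snd.fst.prodMk measurable_const))).prodMk
    (m.measurable_f.comp (measurable_fst.snd.prodMk
      (measurable_snd.snd.prodMk measurable_const)))
  set Q : L → Kernel (F × F) (F × F) := fun x =>
    (Kernel.id ×ₖ ξ).map (fun u => (m.f u.1.1 u.2.1 x, m.f u.1.2 u.2.2 x)) with hQ
  have hQa : ∀ x z, Q x z = (ξ z).map (fun y => (m.f z.1 y.1 x, m.f z.2 y.2 x)) := by
    intro x z
    rw [hQ]
    simp only
    rw [Kernel.map_apply _ (mu x), Kernel.prod_apply, Kernel.id_apply, Measure.dirac_prod,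
      Measure.map_map (mu x) measurable_prodMk_left]
    rfl
  refine ⟨Q, fun x => ⟨Kernel.IsMarkovKernel.map _ (mu x), ?_, ?_, fun z S mS hS => ?_⟩⟩
  · ext1 z
    rw [Kernel.map_apply _ measurable_fst, hQa, Measure.map_map measurable_fst (mz x z),
      Kernel.comap_apply, m.P_apply,
      show m.p z.1 = (m.p.comap (Prod.fst : F × F → F) measurable_fst) z from rfl, ← h1,
      Kernel.map_apply _ measurable_fst, Measure.map_map (mf x z.1) measurable_fst]
    rfl
  · ext1 z
    rw [Kernel.map_apply _ measurable_snd, hQa, Measure.map_map measurable_snd (mz x z),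
      Kernel.comap_apply, m.P_apply,
      show m.p z.2 = (m.p.comap (Prod.snd : F × F → F) measurable_snd) z from rfl, ← h2,
      Kernel.map_apply _ measurable_snd, Measure.map_map (mf x z.2) measurable_snd]
    rfl
  · refine (h3 z).trans ?_
    rw [hQa, Measure.map_apply (mz x z) mS]
    refine measure_mono fun y hy => ?_
    have hy' : y.1 = y.2 := hy
    change (m.f z.1 y.1 x, m.f z.2 y.2 x) ∈ S
    rw [← hy']
    exact hS y.1

/-- Along every environment, the coupled kernels form a coupled chain with the right marginals. -/
theorem exists_coupledChain {Ω : Type*} [MeasurableSpace Ω] {P : Measure Ω} {X : ℤ → Ω → L}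
    {m : ObsModel E F L} {N : Seminorm ℝ (Fin k → ℝ)} {κ γ δ : L → ℝ≥0} {V : F → ℝ≥0} {α : ℝ}
    {φ : Polynomial ℝ} (h1 : A1 P X m N κ) (h2 : A2 P X m N γ δ V α) (h3 : A3 m N φ)
    (x : ℤ → L) :
    ∃ Q : ℕ → Kernel (F × F) (F × F),
      CoupledChain Q (fun z => (N ((z.1 : Fin k → ℝ) - (z.2 : Fin k → ℝ))).toNNReal)
        (fun z => V z.1 + V z.2) (fun t => κ (x t)) (fun t => γ (x t)) (fun t => δ (x t)) φ ∧
      ∀ (n : ℕ) (z : F × F), (iterKernel Q 0 n z).map Prod.fst = m.forward x z.1 n ∧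
        (iterKernel Q 0 n z).map Prod.snd = m.forward x z.2 n := by
  obtain ⟨Q, hQ⟩ := m.exists_coupled_kernel
  -- A convex function on a finite-dimensional space is locally Lipschitz; this gives measurability
  -- of `D`.
  have hN : Continuous N := (Seminorm.convexOn N).locallyLipschitz.continuous
  have mN : Measurable fun z : F × F =>
      (N ((z.1 : Fin k → ℝ) - (z.2 : Fin k → ℝ))).toNNReal :=
    (hN.measurable.comp ((measurable_subtype_coe.comp measurable_fst).sub
      (measurable_subtype_coe.comp measurable_snd))).real_toNNReal
  have mV := h2.measurable_V.coe_nnreal_ennreal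
  refine ⟨fun t => Q (x t), ⟨fun t => (hQ _).1, mN,
    (h2.measurable_V.comp measurable_fst).add (h2.measurable_V.comp measurable_snd),
    fun t z => ?_, fun t z => ?_⟩, fun n z => ⟨?_, ?_⟩⟩
  · refine le_trans (ENNReal.ofReal_le_ofReal ?_) ((hQ (x t)).2.2.2 z _
      (measurableSet_le mN measurable_const) fun y => ?_)
    · rw [Real.coe_toNNReal _ (apply_nonneg N _)]
      linarith [h3 z.1 z.2]
    · change (N _).toNNReal ≤ κ (x t) * (N _).toNNReal
      rw [Real.toNNReal_le_iff_le_coe, NNReal.coe_mul, Real.coe_toNNReal _ (apply_nonneg N _)]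
      exact h1.contraction y z.1 z.2 (x t)
  · have e1 : ∫⁻ z', (V z'.1 : ℝ≥0∞) ∂(Q (x t) z) = ∫⁻ s, (V s : ℝ≥0∞) ∂(m.P (x t) z.1) := by
      rw [← Kernel.comap_apply (m.P (x t)) measurable_fst z, ← (hQ (x t)).2.1,
        Kernel.map_apply _ measurable_fst, lintegral_map mV measurable_fst]
    have e2 : ∫⁻ z', (V z'.2 : ℝ≥0∞) ∂(Q (x t) z) = ∫⁻ s, (V s : ℝ≥0∞) ∂(m.P (x t) z.2) := by
      rw [← Kernel.comap_apply (m.P (x t)) measurable_snd z, ← (hQ (x t)).2.2.1,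
        Kernel.map_apply _ measurable_snd, lintegral_map mV measurable_snd]
    simp only [ENNReal.coe_add]
    have mV1 : Measurable fun z' : F × F => (V z'.1 : ℝ≥0∞) := mV.comp measurable_fst
    rw [lintegral_add_left mV1, e1, e2]
    refine (add_le_add (h2.drift z.1 (x t)) (h2.drift z.2 (x t))).trans (le_of_eq ?_)
    ring
  · exact map_iterKernel_eq_forward m x measurable_fst (fun t => (hQ (x t)).2.1) n z
  · exact map_iterKernel_eq_forward m x measurable_snd (fun t => (hQ (x t)).2.2.1) n z

/-- Bounded Lyapunov values force a bounded distance, as the middle case of the Harris step needs.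
-/
theorem le_rpow_of_V_ge {N : Seminorm ℝ (Fin k → ℝ)} {V : F → ℝ≥0} {α : ℝ} (hα : 0 < α)
    (hV : ∀ s : F, N (s : Fin k → ℝ) ^ α ≤ V s) (s s' : F) :
    N ((s : Fin k → ℝ) - (s' : Fin k → ℝ)) ≤ 2 * ((V s : ℝ) + V s') ^ (1 / α) := by
  have key : ∀ (u : F) (w : ℝ), (V u : ℝ) ≤ w → N (u : Fin k → ℝ) ≤ w ^ (1 / α) := by
    intro u w hw
    have := Real.rpow_le_rpow (Real.rpow_nonneg (apply_nonneg N _) _) ((hV u).trans hw)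
      (show 0 ≤ 1 / α by positivity)
    rwa [← Real.rpow_mul (apply_nonneg N _), mul_one_div_cancel hα.ne', Real.rpow_one] at this
  have h1 := key s (V s + V s') (le_add_of_nonneg_right (V s').2)
  have h2 := key s' (V s + V s') (le_add_of_nonneg_left (V s).2)
  linarith [map_sub_le_add N (s : Fin k → ℝ) (s' : Fin k → ℝ)]

end Model

end RandomEnv

/-! ### Conclusion -/

theorem mainTheorem3
    (C : ℝ) (hC : 1 < C)
    (α : ℝ) (hα : 0 < α ∧ α ≤ 1)
    (φ : Polynomial ℝ) (hφ_ne : φ ≠ 0) (hφ_zero : φ.coeff 0 = 0) (hφ_nonneg : ∀ j, 0 ≤ φ.coeff j) :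
    ∃ Cbar ρbar : ℝ, 0 < Cbar ∧ 0 < ρbar ∧ ρbar < 1 ∧
      ∀ (g k d : ℕ) (E : Set (Fin g → ℝ)) (F : Set (Fin k → ℝ)) (L : Set (Fin d → ℝ)),
      MeasurableSet E → MeasurableSet F → MeasurableSet L →
      ∀ (Ω : Type*) [MeasurableSpace Ω] (P : Measure Ω) [IsProbabilityMeasure P]
        (X : ℤ → Ω → L),
      RandomEnv.IsStationaryErgodic P X →
      ∀ (m : RandomEnv.ObsModel E F L) (N : Seminorm ℝ (Fin k → ℝ))
        (κ γ δ : L → ℝ≥0) (V : F → ℝ≥0),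
      RandomEnv.A1 P X m N κ → RandomEnv.A2 P X m N γ δ V α → RandomEnv.A3 m N φ →
      ∀ h : ℕ, 1 ≤ h →
      ∀ᵐ ω ∂P, ∀ (n : ℕ) (s s' : F),
        RandomEnv.W1 N
            (m.forward (fun t => X t ω) s n) (m.forward (fun t => X t ω) s' n) ≤
          ENNReal.ofReal (Cbar * (1 + V s + V s') *
            ρbar ^ Real.sqrt (RandomEnv.goodCount h
              (RandomEnv.IsGoodTime C h φ
                (fun t => κ (X t ω)) (fun t => γ (X t ω)) (fun t => δ (X t ω))) n)) := by
  obtain ⟨Cbar, ρbar, hC0, hρ0, hρ1, H⟩ :=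
    RandomEnv.CoupledChain.exists_lintegral_min_le hC hα.1 hφ_ne hφ_zero hφ_nonneg
  refine ⟨Cbar, ρbar, hC0, hρ0, hρ1, ?_⟩
  intro g k d E F L _ _ _ Ω _ P _ X _ m N κ γ δ V h1 h2 h3 h _
  refine Filter.Eventually.of_forall fun ω n s s' => ?_
  obtain ⟨Q, hQ, hmarg⟩ := RandomEnv.exists_coupledChain h1 h2 h3 (fun t => X t ω)
  have := hQ.markov
  have hb := H h n hQ (fun z => by
    rw [Real.coe_toNNReal _ (apply_nonneg N _), NNReal.coe_add]
    exact RandomEnv.le_rpow_of_V_ge hα.1 h2.V_ge z.1 z.2) (s, s')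
  refine (iInf₂_le (RandomEnv.iterKernel Q 0 n (s, s'))
    ⟨inferInstance, (hmarg n (s, s')).1, (hmarg n (s, s')).2⟩).trans ?_
  simp only [Real.coe_toNNReal _ (apply_nonneg N _), NNReal.coe_add, ← add_assoc] at hb
  simpa only [min_comm] using hb
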